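/- Let $R$ be an integral domain of characteristic $0$ and $F$ a one-dimensional commutative formal group law over $R$. Let $(T^*,\Phi,Q^\vee,\Phi^\vee)$ be the root datum of a simple, simply connected complex algebraic group $G\supset T$, so that $\Phi$ is irreducible and reduced and the cocharacter lattice is the coroot lattice $Q^\vee$. Let $W$ be the Weyl group, $\alpha_i$ ($i\in I$) the simple roots with reflections $s_i$, $\theta$ the highest root, and $W_a=Q^\vee\rtimes W$ the affine Weyl group, with elements $t_\lambda w$ ($\lambda\in Q^\vee$, $w\in W$) and $s_0=t_{\theta^\vee}s_\theta$. *Small torus.* Let $S=R[[x_\mu\mid\mu\in T^*]]/\mathcal J_F$ be the formal group algebra of $T^*$ (so $x_0=0$, $x_{\mu+\nu}=F(x_\mu,x_\nu)$, and $S$ is a power series ring over $R$ in $\operatorname{rank}T^*$ variables). The group $W_a$ acts on $T^*$, and hence on $S$, by $t_\lambda w(\mu)=w(\mu)$. Let $\mathcal Q=S[1/x_\alpha,\ \alpha\in\Phi]$. Let $\mathcal Q_{W_a}=\mathcal Q\rtimes R[W_a]$ be the free left $\mathcal Q$-module with basis $\eta_w$ ($w\in W_a$) and product $c\,\eta_w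 c'\eta_{w'}=c\,w(c')\,\eta_{ww'}$, and let $\mathcal Q_{Q^\vee}=\mathcal Q\rtimes R[Q^\vee]$, with basis $\eta_{t_\lambda}$. Let $\mathrm{pr}:\mathcal Q_{W_a}\to\mathcal Q_{Q^\vee}$ and $k:\mathcal Q_{Q^\vee}\to\mathcal Q_{W_a}$ be the left $\mathcal Q$-linear maps with $\mathrm{pr}(\eta_{t_\lambda w})=\eta_{t_\lambda}$ for $w\in W$ and $k(\eta_{t_\lambda})=\eta_{t_\lambda}$, and let $$k^*:\operatorname{Hom}_{\mathcal Q}(\mathcal Q_{W_a},\mathcal Q)\to\operatorname{Hom}_{\mathcal Q}(\mathcal Q_{Q^\vee},\mathcal Q),\qquad f\mapsto f\circ k .$$ Put $X_i=\frac1{x_{\alpha_i}}(1-\eta_{s_i})$ for $i\in I$ and $X_0=\frac1{x_{-\theta}}(1-\eta_{s_0})$. Let $\mathbf D_{W_a}$ be the subalgebra of $\mathcal Q_{W_a}$ generated by $S$ and all $X_i$ ($i\in I\cup\{0\}$), and let $\mathbf D_{W_a/W}=\mathrm{pr}(\mathbf D_{W_a})$. Let $\mathbf D_{W_a}^*=\operatorname{Hom}_S(\mathbf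 D_{W_a},S)$ and $\mathbf D_{W_a/W}^*=\operatorname{Hom}_S(\mathbf D_{W_a/W},S)$, regarded as the sets of those $\mathcal Q$-linear forms in $\operatorname{Hom}_{\mathcal Q}(\mathcal Q_{W_a},\mathcal Q)$, respectively $\operatorname{Hom}_{\mathcal Q}(\mathcal Q_{Q^\vee},\mathcal Q)$, whose restriction to $\mathbf D_{W_a}$, respectively $\mathbf D_{W_a/W}$, is an $S$-linear form with values in $S$. *Big torus.* Let $T_a^*=T^*\oplus\mathbb Z\delta$, on which $W_a$ acts by $t_\lambda w(\mu+m\delta)=w(\mu)+(m-\langle w(\mu),\lambda\rangle)\delta$, let $\Phi_a=\Phi+\mathbb Z\delta$ and $\alpha_0=-\theta+\delta$. Define $\hat S$, $\hat{\mathcal Q}$, $\hat{\mathbf D}_{W_a}$, $\hat{\mathbf D}_{W_a/W}$, $\mathrm{pr}$ and $k$ in the same way, with $T_a^*$, $\Phi_a$ and $\hat X_0=\frac1{x_{\alpha_0}}(1-\eta_{s_0})$ in place of $T^*$, $\Phi$ and $X_0$. Then: 1. $k^*(\mathbf D_{W_a}^*)\subseteq\mathbf D_{W_a/W}^*$; 2.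 $k(\mathbf D_{W_a/W})\subseteq\mathbf D_{W_a}$; 3. for the big torus, by contrast, $k(\hat{\mathbf D}_{W_a/W})\not\subseteq\hat{\mathbf D}_{W_a}$. Moreover, for $F(x,y)=x+y-cxy$ with $c\in R$, the same three assertions hold when $S$ and $\hat S$ are replaced by their polynomial versions $R[x_\mu]/(x_0,\ x_{\mu+\nu}-x_\mu-x_\nu+c\,x_\mu x_\nu)$, where $\mu,\nu$ run over $T^*$ and $T_a^*$ respectively. -/

import Mathlib

noncomputable section

namespace AffineFADA

universe u v

/-! ### Formal group laws: inverses -/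

section FormalGroupLaw

open MvPowerSeries

variable {R : Type*} [CommRing R]

theorem exists_fixedPoint_of_contracting (T : PowerSeries R → PowerSeries R)
    (hT : ∀ (n : ℕ) (y z : PowerSeries R),
      (∀ m < n, PowerSeries.coeff m y = PowerSeries.coeff m z) →
      PowerSeries.coeff n (T y) = PowerSeries.coeff n (T z)) :
    ∃ y, T y = y := by
  classical
  let c : ℕ → R := fun n => Nat.strongRecOn n (fun n ih =>
    PowerSeries.coeff n (T (PowerSeries.mk fun m => if h : m < n then ih m h else 0)))
  have hc : ∀ n, c n =
      PowerSeries.coeff n (T (PowerSeries.mk fun m => if m < n then c m else 0)) := by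
    intro n
    have h := Nat.strongRecOn_eq (motive := fun _ => R) (fun n ih =>
      PowerSeries.coeff n (T (PowerSeries.mk fun m => if h : m < n then ih m h else 0))) n
    simpa [c] using h
  refine ⟨PowerSeries.mk c, ?_⟩
  ext n
  rw [PowerSeries.coeff_mk, hc n]
  apply hT
  intro m hm
  simp [hm]

theorem coeff_X_pow_mul_pow_congr {n a b : ℕ} {y z : PowerSeries R}
    (hy : PowerSeries.constantCoeff y = 0) (hz : PowerSeries.constantCoeff z = 0)
    (h : ∀ m < n, PowerSeries.coeff m y = PowerSeries.coeff m z) (hab : ¬ (a = 0 ∧ b = 1)) :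
    PowerSeries.coeff n (PowerSeries.X ^ a * y ^ b) =
      PowerSeries.coeff n (PowerSeries.X ^ a * z ^ b) := by
  have hyX : (PowerSeries.X : PowerSeries R) ∣ y := PowerSeries.X_dvd_iff.2 hy
  have hzX : (PowerSeries.X : PowerSeries R) ∣ z := PowerSeries.X_dvd_iff.2 hz
  have hd : (PowerSeries.X : PowerSeries R) ^ n ∣ y - z :=
    PowerSeries.X_pow_dvd_iff.2 fun m hm => by simp [h m hm]
  have key : (PowerSeries.X : PowerSeries R) ^ (n + 1) ∣
      PowerSeries.X ^ a * y ^ b - PowerSeries.X ^ a * z ^ b := by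
    rw [← mul_sub]
    match b with
    | 0 => simp
    | 1 =>
      obtain ⟨a, rfl⟩ : ∃ a', a = a' + 1 := ⟨a - 1, by omega⟩
      rw [pow_one, pow_one, pow_succ' _ n, pow_succ' _ a, mul_assoc]
      exact mul_dvd_mul_left _ (Dvd.dvd.mul_left hd _)
    | b + 2 =>
      apply Dvd.dvd.mul_left
      have e : y ^ (b + 2) - z ^ (b + 2) =
          y * (y ^ (b + 1) - z ^ (b + 1)) + z ^ b * (z * (y - z)) := by ring
      rw [e, pow_succ' _ n]
      exact dvd_add (mul_dvd_mul hyX (hd.trans (sub_dvd_pow_sub_pow _ _ _)))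
        (Dvd.dvd.mul_left (mul_dvd_mul hzX hd) _)
  have := PowerSeries.X_pow_dvd_iff.1 key n (Nat.lt_succ_self n)
  rwa [map_sub, sub_eq_zero] at this

/-- Every one-dimensional formal group law has a formal inverse `i(X)`, i.e. `F(X, i(X)) = 0`. -/
theorem exists_formalInverse (F : FormalGroup R) :
    ∃ i : PowerSeries R, PowerSeries.constantCoeff i = 0 ∧
      F.toPowerSeries.subst ![PowerSeries.X, i] = (0 : PowerSeries R) := by
  let r : PowerSeries R → PowerSeries R := fun y =>
    y - PowerSeries.C (PowerSeries.constantCoeff y)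
  have hr : ∀ y, PowerSeries.constantCoeff (r y) = 0 := fun y => by simp [r]
  have hs : ∀ y : PowerSeries R, PowerSeries.constantCoeff y = 0 →
      HasSubst (![PowerSeries.X, y] : Fin 2 → MvPowerSeries Unit R) := fun y hy =>
    hasSubst_of_constantCoeff_zero fun s => by
      fin_cases s
      · exact PowerSeries.constantCoeff_X
      · exact hy
  let H : MvPowerSeries (Fin 2) R := X 1 - F.toPowerSeries
  have hH : H.coeff (Finsupp.single 1 1) = 0 := by
    simp [H, F.lin_coeff_Y, coeff_X]
  have hH0 : H.constantCoeff = 0 := by simp [H, F.zero_constantCoeff]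
  obtain ⟨y, hy⟩ := exists_fixedPoint_of_contracting
    (fun y => (H.subst ![PowerSeries.X, r y] : MvPowerSeries Unit R)) (by
      intro n y z h
      have h' : ∀ m < n, PowerSeries.coeff m (r y) = PowerSeries.coeff m (r z) := by
        intro m hm
        have h0 := h 0 (by omega)
        have hm' := h m hm
        simp only [PowerSeries.coeff_zero_eq_constantCoeff] at h0
        simp [r, h0, hm']
      simp only [PowerSeries.coeff]
      rw [coeff_subst (hs _ (hr y)), coeff_subst (hs _ (hr z))]
      refine finsum_congr fun d => ?_
      by_cases hd : d 0 = 0 ∧ d 1 = 1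
      · have : d = Finsupp.single 1 1 := by
          ext s; fin_cases s <;> simp [hd.1, hd.2]
        rw [this, hH, zero_smul, zero_smul]
      · congr 1
        have := coeff_X_pow_mul_pow_congr (hr y) (hr z) h' hd
        simpa [Finsupp.prod_fintype, PowerSeries.coeff] using this)
  have hy0 : PowerSeries.constantCoeff y = 0 := by
    rw [← hy]
    exact constantCoeff_subst_eq_zero (hs _ (hr y)) (fun s => by
      fin_cases s
      · exact PowerSeries.constantCoeff_X
      · exact hr y) hH0
  have hry : r y = y := by simp [r, hy0]
  refine ⟨y, hy0, ?_⟩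
  simp only [hry] at hy
  rw [subst_sub (hs y hy0), subst_X (hs y hy0)] at hy
  simpa using hy

/-- A formal inverse of `F`: a power series `i(X)` with `F(X, i(X)) = 0`. -/
def formalInverse (F : FormalGroup R) : PowerSeries R := (exists_formalInverse F).choose

theorem constantCoeff_formalInverse (F : FormalGroup R) :
    PowerSeries.constantCoeff (formalInverse F) = 0 := (exists_formalInverse F).choose_spec.1

theorem subst_X_formalInverse (F : FormalGroup R) :
    F.toPowerSeries.subst ![PowerSeries.X, formalInverse F] = (0 : PowerSeries R) :=
  (exists_formalInverse F).choose_spec.2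

/-- `-_F f = i(f)`, the negative of a point of the formal group. -/
def pointNeg (F : FormalGroup R) {σ : Type*} (f : F.Point σ) : F.Point σ :=
  ⟨(formalInverse F).subst f.1, IsNilpotent_subst f.2.const (by
    have := constantCoeff_formalInverse F
    rw [PowerSeries.constantCoeff] at this
    rw [this]; exact IsNilpotent.zero)⟩

theorem add_pointNeg (F : FormalGroup R) {σ : Type*} (f : F.Point σ) : f + pointNeg F f = 0 := by
  apply Subtype.ext
  have hs : HasSubst (![PowerSeries.X, formalInverse F] : Fin 2 → MvPowerSeries Unit R) :=
    hasSubst_of_constantCoeff_zero fun s => by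
      fin_cases s
      · exact PowerSeries.constantCoeff_X
      · exact constantCoeff_formalInverse F
  have h := congrArg (MvPowerSeries.subst (fun _ : Unit => f.1)) (subst_X_formalInverse F)
  rw [subst_comp_subst_apply hs f.2.const] at h
  have h0 : MvPowerSeries.subst (fun _ : Unit => f.1) (0 : MvPowerSeries Unit R) = 0 := by
    rw [← substAlgHom_apply (R := R) f.2.const, map_zero]
  rw [FormalGroup.add_apply]
  refine Eq.trans ?_ (h.trans h0)
  congr 1
  ext1 s
  fin_cases s
  · exact (subst_X (R := R) f.2.const ()).symm
  · rfl

instance pointHasNeg (F : FormalGroup R) (σ : Type*) : Neg (F.Point σ) := ⟨pointNeg F⟩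

/-- The points of a commutative formal group form an abelian group. -/
instance pointAddCommGroup (F : FormalGroup R) [F.IsComm] (σ : Type*) :
    AddCommGroup (F.Point σ) :=
  { (inferInstance : AddCommMonoid (F.Point σ)) with
    zsmul := zsmulRec
    neg_add_cancel := fun f => by rw [add_comm]; exact add_pointNeg F f }

/-- The variable `X i`, as a point of the formal group. -/
def varPoint (F : FormalGroup R) {σ : Type*} (i : σ) : F.Point σ :=
  ⟨X i, PowerSeries.HasSubst.X i⟩

/-- Substitution of power series, as a homomorphism on points of a formal group. -/
def pointSubst (F : FormalGroup R) [F.IsComm] {σ τ : Type*} (a : σ → MvPowerSeries τ R)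
    (ha : HasSubst a) : F.Point σ →+ F.Point τ :=
  AddMonoidHom.mk' (fun f => ⟨subst a f.1, IsNilpotent_subst ha f.2⟩) (fun f g => by
    apply Subtype.ext
    have hs : HasSubst (![f.1, g.1] : Fin 2 → MvPowerSeries σ R) :=
      hasSubst_of_constantCoeff_nilpotent fun s => by
        fin_cases s
        · exact f.2
        · exact g.2
    change subst a (F.toPowerSeries.subst ![f.1, g.1]) =
      F.toPowerSeries.subst ![subst a f.1, subst a g.1]
    rw [subst_comp_subst_apply hs ha]
    congr 1
    ext1 s
    fin_cases s <;> rfl)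

end FormalGroupLaw

/-! ### The formal group algebra of a lattice (power series version) -/

section FormalGroupAlgebra

open MvPowerSeries

variable {R : Type*} [CommRing R] (F : FormalGroup R) [F.IsComm]
variable (L : Type*) [AddCommGroup L] [Module.Free ℤ L]

/-- The formal group algebra `R[[x_μ | μ ∈ L]] / J_F` of a lattice `L`, realised, after the choice
of a basis `(e_i)` of `L`, as the ring of formal power series in the variables `x_{e_i}`. -/
def FormalGroupAlgebra (_F : FormalGroup R) (L : Type*) [AddCommGroup L] [Module.Free ℤ L]
    [Module.Finite ℤ L] : Type _ :=
  MvPowerSeries (Module.Free.ChooseBasisIndex ℤ L) R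

instance formalGroupAlgebraCommRing (F : FormalGroup R) (L : Type*) [AddCommGroup L]
    [Module.Free ℤ L] [Module.Finite ℤ L] : CommRing (FormalGroupAlgebra F L) :=
  inferInstanceAs (CommRing (MvPowerSeries (Module.Free.ChooseBasisIndex ℤ L) R))

/-- The homomorphism `μ ↦ x_μ` from `L` to the points of the formal group that sends the
basis vector `e_i` to the variable `x_{e_i}`. In particular `x_0 = 0` and
`x_{μ+ν} = F(x_μ, x_ν)`. -/
def chernPoint : L →+ F.Point (Module.Free.ChooseBasisIndex ℤ L) :=
  ((Module.Free.chooseBasis ℤ L).constr ℤ (varPoint F)).toAddMonoidHom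

variable {L}

/-- The power series `x_μ`. -/
def chernSeries (μ : L) : MvPowerSeries (Module.Free.ChooseBasisIndex ℤ L) R :=
  Subtype.val (chernPoint F L μ)

theorem chernSeries_zero : chernSeries F (0 : L) = 0 :=
  congrArg Subtype.val (map_zero (chernPoint F L))

theorem chernSeries_add (μ ν : L) : chernSeries F (μ + ν) =
    F.toPowerSeries.subst ![chernSeries F μ, chernSeries F ν] :=
  congrArg Subtype.val (map_add (chernPoint F L) μ ν)

theorem chernSeries_basis (i : Module.Free.ChooseBasisIndex ℤ L) :
    chernSeries F (Module.Free.chooseBasis ℤ L i) = X i :=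
  congrArg Subtype.val ((Module.Free.chooseBasis ℤ L).constr_basis ℤ (varPoint F) i)

variable [Module.Finite ℤ L]

/-- The element `x_μ` of the formal group algebra. -/
def chern (μ : L) : FormalGroupAlgebra F L := chernSeries F μ

theorem hasSubst_chernSeries (φ : L →+ L) :
    HasSubst (fun i => chernSeries F (φ (Module.Free.chooseBasis ℤ L i))) :=
  hasSubst_of_constantCoeff_nilpotent fun _ => Subtype.property (chernPoint F L _)

theorem subst_chernSeries (φ : L →+ L) (μ : L) :
    subst (R := R) (fun i => chernSeries F (φ (Module.Free.chooseBasis ℤ L i)))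
      (chernSeries F μ) = chernSeries F (φ μ) := by
  have key : (pointSubst F _ (hasSubst_chernSeries F φ)).comp (chernPoint F L) =
      (chernPoint F L).comp φ := by
    apply AddMonoidHom.toIntLinearMap_injective
    refine (Module.Free.chooseBasis ℤ L).ext fun i => ?_
    apply Subtype.ext
    change subst _ (chernSeries F (Module.Free.chooseBasis ℤ L i)) =
      chernSeries F (φ (Module.Free.chooseBasis ℤ L i))
    rw [chernSeries_basis, subst_X (hasSubst_chernSeries F φ)]
  exact congrArg Subtype.val (DFunLike.congr_fun key μ)

/-- The `R`-algebra endomorphism of the formal group algebra induced by an endomorphism `φ` of the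
lattice: the continuous one with `x_{e_i} ↦ x_{φ(e_i)}`. -/
def inducedHom (φ : L →+ L) : FormalGroupAlgebra F L →+* FormalGroupAlgebra F L :=
  (substAlgHom (R := R) (hasSubst_chernSeries F φ)).toRingHom

theorem inducedHom_apply (φ : L →+ L)
    (p : MvPowerSeries (Module.Free.ChooseBasisIndex ℤ L) R) :
    inducedHom F φ p =
      subst (R := R) (fun i => chernSeries F (φ (Module.Free.chooseBasis ℤ L i))) p :=
  substAlgHom_apply _ _

theorem inducedHom_chern (φ : L →+ L) (μ : L) :
    inducedHom F φ (chern F μ) = chern F (φ μ) :=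
  (inducedHom_apply F φ _).trans (subst_chernSeries F φ μ)

theorem inducedHom_id (p : FormalGroupAlgebra F L) :
    inducedHom F (AddMonoidHom.id L) p = p := by
  refine (inducedHom_apply F _ p).trans ?_
  have : (fun i => chernSeries F (AddMonoidHom.id L (Module.Free.chooseBasis ℤ L i))) =
      (X : _ → MvPowerSeries (Module.Free.ChooseBasisIndex ℤ L) R) :=
    funext fun i => chernSeries_basis F i
  rw [this, subst_self]
  rfl

theorem inducedHom_comp (φ ψ : L →+ L) (p : FormalGroupAlgebra F L) :
    inducedHom F (φ.comp ψ) p = inducedHom F φ (inducedHom F ψ p) := by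
  refine (inducedHom_apply F _ p).trans ?_
  refine Eq.trans ?_ (congrArg (inducedHom F φ) (inducedHom_apply F ψ p)).symm
  refine Eq.trans ?_ (inducedHom_apply F φ _).symm
  have key (q : MvPowerSeries (Module.Free.ChooseBasisIndex ℤ L) R) :
      subst (R := R) (fun i => chernSeries F (φ.comp ψ (Module.Free.chooseBasis ℤ L i))) q =
        subst (R := R) (fun i => chernSeries F (φ (Module.Free.chooseBasis ℤ L i)))
          (subst (R := R) (fun i => chernSeries F (ψ (Module.Free.chooseBasis ℤ L i))) q) := by
    rw [subst_comp_subst_apply (hasSubst_chernSeries F ψ) (hasSubst_chernSeries F φ)]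
    congr 1
    ext1 i
    exact (subst_chernSeries F φ _).symm
  exact key p

/-- An action of a group on the lattice `L` induces one on the formal group algebra. -/
instance formalGroupAlgebraAction {Γ : Type*} [Group Γ] [DistribMulAction Γ L] :
    MulSemiringAction Γ (FormalGroupAlgebra F L) where
  smul g p := inducedHom F (DistribSMul.toAddMonoidHom L g) p
  one_smul p := by
    change inducedHom F (DistribSMul.toAddMonoidHom L (1 : Γ)) p = p
    rw [show DistribSMul.toAddMonoidHom L (1 : Γ) = AddMonoidHom.id L by ext; simp]
    exact inducedHom_id F p
  mul_smul g h p := by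
    change inducedHom F (DistribSMul.toAddMonoidHom L (g * h)) p = inducedHom F _ (inducedHom F _ p)
    rw [← inducedHom_comp]
    congr 2
    ext μ
    exact mul_smul g h μ
  smul_zero g := map_zero _
  smul_add g := map_add _
  smul_one g := map_one _
  smul_mul g := map_mul _

theorem smul_chern {Γ : Type*} [Group Γ] [DistribMulAction Γ L] (g : Γ) (μ : L) :
    g • chern F μ = chern F (g • μ) :=
  inducedHom_chern F (DistribSMul.toAddMonoidHom L g) μ

end FormalGroupAlgebra

/-! ### The formal group algebra of a lattice (polynomial version, connective case) -/

section ConnectiveAlgebra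

variable {R : Type*} [CommRing R] (c : R) (L : Type*) [AddCommGroup L]

/-- The ideal generated by `x_0` and the `x_{μ+ν} - (x_μ + x_ν - c x_μ x_ν)`. -/
def connectiveIdeal : Ideal (MvPolynomial L R) :=
  Ideal.span ({MvPolynomial.X 0} ∪ Set.range fun p : L × L =>
    MvPolynomial.X (p.1 + p.2) - (MvPolynomial.X p.1 + MvPolynomial.X p.2
      - MvPolynomial.C c * (MvPolynomial.X p.1 * MvPolynomial.X p.2)))

/-- The polynomial version `R[x_μ | μ ∈ L] / J_F` of the formal group algebra for the connective
formal group law `F(x, y) = x + y - c x y`. -/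
abbrev ConnectiveAlgebra : Type _ := MvPolynomial L R ⧸ connectiveIdeal c L

variable {L}

/-- The element `x_μ` of the polynomial version of the formal group algebra. -/
def connectiveChern (μ : L) : ConnectiveAlgebra c L :=
  Ideal.Quotient.mk (connectiveIdeal c L) (MvPolynomial.X μ)

theorem connectiveIdeal_le_comap (φ : L →+ L) :
    connectiveIdeal c L ≤
      (connectiveIdeal c L).comap (MvPolynomial.rename (R := R) φ).toRingHom := by
  refine Ideal.span_le.2 ?_
  rintro _ (rfl | ⟨⟨μ, ν⟩, rfl⟩)
  · refine Ideal.subset_span (Or.inl ?_)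
    simp
  · refine Ideal.subset_span (Or.inr ⟨(φ μ, φ ν), ?_⟩)
    simp

/-- The `R`-algebra endomorphism `x_μ ↦ x_{φ(μ)}`. -/
def connectiveHom (φ : L →+ L) : ConnectiveAlgebra c L →+* ConnectiveAlgebra c L :=
  Ideal.quotientMap _ (MvPolynomial.rename (R := R) φ).toRingHom (connectiveIdeal_le_comap c φ)

theorem connectiveHom_mk (φ : L →+ L) (p : MvPolynomial L R) :
    connectiveHom c φ (Ideal.Quotient.mk _ p) =
      Ideal.Quotient.mk _ (MvPolynomial.rename φ p) := rfl

/-- An action of a group on the lattice `L` induces one on the algebra. -/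
instance connectiveAlgebraAction {Γ : Type*} [Group Γ] [DistribMulAction Γ L] :
    MulSemiringAction Γ (ConnectiveAlgebra c L) where
  smul g p := connectiveHom c (DistribSMul.toAddMonoidHom L g) p
  one_smul p := by
    obtain ⟨p, rfl⟩ := Ideal.Quotient.mk_surjective p
    change connectiveHom c (DistribSMul.toAddMonoidHom L (1 : Γ)) _ = _
    rw [connectiveHom_mk, show ⇑(DistribSMul.toAddMonoidHom L (1 : Γ)) = id by ext; simp,
      MvPolynomial.rename_id_apply]
  mul_smul g h p := by
    obtain ⟨p, rfl⟩ := Ideal.Quotient.mk_surjective p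
    change connectiveHom c (DistribSMul.toAddMonoidHom L (g * h)) _ =
      connectiveHom c _ (connectiveHom c _ _)
    simp only [connectiveHom_mk, MvPolynomial.rename_rename]
    congr 2
    ext1 μ
    simp [mul_smul]
  smul_zero g := map_zero _
  smul_add g := map_add _
  smul_one g := map_one _
  smul_mul g := map_mul _

theorem smul_connectiveChern {Γ : Type*} [Group Γ] [DistribMulAction Γ L] (g : Γ) (μ : L) :
    g • connectiveChern c μ = connectiveChern c (g • μ) := by
  change connectiveHom c (DistribSMul.toAddMonoidHom L g) _ = _
  simp [connectiveChern, connectiveHom_mk]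

end ConnectiveAlgebra

/-! ### Localised twisted group algebras, Demazure elements, duals -/

/-- The input of the construction: a group `Γ` acting on a lattice `L` and on a ring `A`, an
equivariant map `μ ↦ x_μ` from `L` to `A`, a stable set of roots in `L`, and simple roots together
with their reflections. -/
structure Model (Γ J L A : Type*) [Group Γ] [AddCommGroup L] [DistribMulAction Γ L] [CommRing A]
    [MulSemiringAction Γ A] where
  x : L → A
  smul_x : ∀ (g : Γ) (μ : L), g • x μ = x (g • μ)
  roots : Set L
  smul_roots : ∀ (g : Γ), ∀ μ ∈ roots, g • μ ∈ roots
  simple : J → roots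
  refl : J → Γ

namespace Model

section General

variable {Γ J L A : Type*} [Group Γ] [AddCommGroup L] [DistribMulAction Γ L] [CommRing A]
  [MulSemiringAction Γ A] (T : Model Γ J L A)

/-- The multiplicative set generated by the `x_α`, `α` a root. -/
def denom : Submonoid A := Submonoid.closure (T.x '' T.roots)

theorem smul_denom (g : Γ) : T.denom ≤ T.denom.comap (MulSemiringAction.toRingHom Γ A g) := by
  refine Submonoid.closure_le.2 ?_
  rintro _ ⟨μ, hμ, rfl⟩
  exact Submonoid.subset_closure ⟨g • μ, T.smul_roots g μ hμ, (T.smul_x g μ).symm⟩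

/-- The localisation `Q = A[1/x_α, α a root]`. -/
abbrev Q : Type _ := Localization T.denom

/-- The action of `Γ` on `A` extends to `Q`. -/
instance actionQ : MulSemiringAction Γ T.Q where
  smul g q := IsLocalization.map T.Q (MulSemiringAction.toRingHom Γ A g) (T.smul_denom g) q
  one_smul q := by
    change IsLocalization.map T.Q (MulSemiringAction.toRingHom Γ A 1) (T.smul_denom 1) q = q
    induction q using Localization.induction_on with
    | H p =>
      rw [Localization.mk_eq_mk', IsLocalization.map_mk']
      congr 1
      · simp
      · ext; simp
  mul_smul g h q := by
    change IsLocalization.map T.Q (MulSemiringAction.toRingHom Γ A (g * h)) (T.smul_denom _) q =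
      IsLocalization.map T.Q (MulSemiringAction.toRingHom Γ A g) (T.smul_denom _)
        (IsLocalization.map T.Q (MulSemiringAction.toRingHom Γ A h) (T.smul_denom _) q)
    induction q using Localization.induction_on with
    | H p =>
      rw [Localization.mk_eq_mk', IsLocalization.map_mk', IsLocalization.map_mk',
        IsLocalization.map_mk']
      congr 1
      · simp [mul_smul]
      · ext; simp [mul_smul]
  smul_zero g := map_zero _
  smul_add g := map_add _
  smul_one g := map_one _
  smul_mul g := map_mul _

theorem smul_algebraMap (g : Γ) (a : A) : g • algebraMap A T.Q a = algebraMap A T.Q (g • a) :=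
  IsLocalization.map_eq (T.smul_denom g) a

/-- The twisted group algebra `Q ⋊ R[Γ]`: the free left `Q`-module on `η_g`, `g ∈ Γ`, with product
`c η_g c' η_h = c g(c') η_{gh}`. -/
abbrev Twisted : Type _ := SkewMonoidAlgebra T.Q Γ

/-- The basis element `η_g`. -/
def η (g : Γ) : T.Twisted := SkewMonoidAlgebra.single g 1

/-- The inverse `1 / x_α` of `x_α` in `Q`, for a root `α`. -/
def invX (α : T.roots) : T.Q :=
  Localization.mk 1 ⟨T.x α, Submonoid.subset_closure ⟨α, α.2, rfl⟩⟩

/-- The Demazure element `X_j = (1 / x_{α_j}) (1 - η_{s_j})`. -/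
def demazure (j : J) : T.Twisted := T.invX (T.simple j) • (1 - T.η (T.refl j))

/-- The embedding of `A` into the twisted group algebra. -/
def coeff (a : A) : T.Twisted := SkewMonoidAlgebra.single 1 (algebraMap A T.Q a)

/-- The formal affine Demazure algebra: the subring generated by `A` and the Demazure elements. -/
def fadaSubring : Subring T.Twisted :=
  Subring.closure (Set.range T.coeff ∪ Set.range T.demazure)

theorem smul_eq_coeff_mul (a : A) (z : T.Twisted) : a • z = T.coeff a * z := by
  ext g
  rw [coeff, SkewMonoidAlgebra.coeff_single_one_mul, SkewMonoidAlgebra.coeff_smul,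
    Finsupp.smul_apply, Algebra.smul_def]

/-- The formal affine Demazure algebra, as a left `A`-module. -/
def fada : Submodule A T.Twisted where
  carrier := T.fadaSubring
  add_mem' := T.fadaSubring.add_mem
  zero_mem' := T.fadaSubring.zero_mem
  smul_mem' a z hz := by
    rw [smul_eq_coeff_mul]
    exact T.fadaSubring.mul_mem (Subring.subset_closure (Or.inl ⟨a, rfl⟩)) hz

/-- For an `A`-submodule `D` of a left `Q`-module `V`, the dual `Hom_A(D, A)`, viewed inside the
dual `V^* = Hom_Q(V, Q)`: those `Q`-linear forms on `V` that restrict to an `A`-linear form on `D`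
with values in `A`. -/
def integralDual {V : Type*} [AddCommGroup V] [Module A V] [Module T.Q V]
    (D : Submodule A V) : Submodule A (Module.Dual T.Q V) where
  carrier := {f | ∃ φ : D →ₗ[A] A, ∀ z : D, f z = algebraMap A T.Q (φ z)}
  add_mem' := by
    rintro f g ⟨φ, hφ⟩ ⟨ψ, hψ⟩
    exact ⟨φ + ψ, fun z => by simp [hφ z, hψ z]⟩
  zero_mem' := ⟨0, fun z => by simp⟩
  smul_mem' := by
    rintro a f ⟨φ, hφ⟩
    exact ⟨a • φ, fun z => by simp [hφ z, Algebra.smul_def]⟩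

end General

section Semidirect

variable {H G J L A : Type*} [Group H] [Group G] {ρ : G →* MulAut H} [AddCommGroup L]
  [DistribMulAction (H ⋊[ρ] G) L] [CommRing A] [MulSemiringAction (H ⋊[ρ] G) A]
  (T : Model (H ⋊[ρ] G) J L A)

/-- The restriction to `H` of the action of `H ⋊ G` on `Q`. -/
instance actionQNormal : MulSemiringAction H T.Q :=
  MulSemiringAction.compHom T.Q (SemidirectProduct.inl : H →* H ⋊[ρ] G)

/-- The twisted group algebra `Q ⋊ R[H]`. -/
abbrev TwistedNormal : Type _ := SkewMonoidAlgebra T.Q H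

/-- The projection `Q ⋊ R[H ⋊ G] → Q ⋊ R[H]`, `c η_{t w} ↦ c η_t` for `t ∈ H`, `w ∈ G`. -/
def pr : T.Twisted →ₗ[T.Q] T.TwistedNormal :=
  (SkewMonoidAlgebra.coeffLinearEquiv (S := T.Q)).symm.toLinearMap ∘ₗ
    Finsupp.lmapDomain T.Q T.Q (fun g : H ⋊[ρ] G => g.left) ∘ₗ
      (SkewMonoidAlgebra.coeffLinearEquiv (S := T.Q)).toLinearMap

/-- The embedding `k : Q ⋊ R[H] → Q ⋊ R[H ⋊ G]`, `c η_t ↦ c η_t` for `t ∈ H`. -/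
def k : T.TwistedNormal →ₗ[T.Q] T.Twisted :=
  (SkewMonoidAlgebra.coeffLinearEquiv (S := T.Q)).symm.toLinearMap ∘ₗ
    Finsupp.lmapDomain T.Q T.Q (SemidirectProduct.inl : H →* H ⋊[ρ] G) ∘ₗ
      (SkewMonoidAlgebra.coeffLinearEquiv (S := T.Q)).toLinearMap

theorem pr_single (g : H ⋊[ρ] G) (c : T.Q) :
    T.pr (SkewMonoidAlgebra.single g c) = SkewMonoidAlgebra.single g.left c := by
  simp [pr, SkewMonoidAlgebra.coeffLinearEquiv, SkewMonoidAlgebra.coeffAddEquiv]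

theorem k_single (t : H) (c : T.Q) :
    T.k (SkewMonoidAlgebra.single t c) =
      SkewMonoidAlgebra.single (SemidirectProduct.inl t) c := by
  simp [k, SkewMonoidAlgebra.coeffLinearEquiv, SkewMonoidAlgebra.coeffAddEquiv]

/-- The map `k^*` dual to `k`. -/
def kDual : Module.Dual T.Q T.Twisted →ₗ[T.Q] Module.Dual T.Q T.TwistedNormal := T.k.dualMap

/-- The relative Demazure module: the image of the formal affine Demazure algebra under `pr`. -/
def relFada : Submodule A T.TwistedNormal := T.fada.map (T.pr.restrictScalars A)

end Semidirect

end Model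

/-! ### The affine Weyl group and the small and big tori -/

section Affine

variable {ι M N : Type*} [AddCommGroup M] [AddCommGroup N] (P : RootPairing ι ℤ M N)

/-- The left action of the Weyl group on the cocharacter lattice, contragredient to its action on
the character lattice. -/
def weylCoaction : P.weylGroup →* MulAut (Multiplicative N) where
  toFun w := AddEquiv.toMultiplicative
    (RootPairing.Equiv.coweightEquiv P P (w⁻¹ : P.weylGroup)).toAddEquiv
  map_one' := by ext; simp
  map_mul' v w := by ext; simp

/-- `⟨w μ, w λ⟩ = ⟨μ, λ⟩`. -/
theorem weylCoaction_pairing (w : P.weylGroup) (μ : M) (l : Multiplicative N) :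
    P.toLinearMap (w • μ) (weylCoaction P w l).toAdd = P.toLinearMap μ l.toAdd := by
  have h := DFunLike.congr_fun (RootPairing.Hom.weight_coweight_transpose_apply P P l.toAdd
    (w⁻¹ : P.weylGroup).1.toHom) (w • μ)
  have h2 : (w⁻¹ : P.weylGroup).1.toHom.weightMap (w • μ) = μ := inv_smul_smul w μ
  rw [LinearMap.dualMap_apply, h2] at h
  exact h.symm

/-- The affine Weyl group `W_a = N ⋊ W`, for `N` the cocharacter lattice (which is the coroot
lattice in the simply connected case); `⟨λ, w⟩` is `t_λ w`, and `w t_λ w⁻¹ = t_{w(λ)}`. -/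
abbrev AffineWeyl : Type _ := Multiplicative N ⋊[weylCoaction P] P.weylGroup

/-- The character lattice `T^*` of the small torus. -/
def SmallChar (_P : RootPairing ι ℤ M N) : Type _ := M

/-- The character lattice `T_a^* = T^* ⊕ ℤδ` of the big torus. -/
def BigChar (_P : RootPairing ι ℤ M N) : Type _ := M × ℤ

instance smallCharAddCommGroup : AddCommGroup (SmallChar P) := inferInstanceAs (AddCommGroup M)

instance bigCharAddCommGroup : AddCommGroup (BigChar P) := inferInstanceAs (AddCommGroup (M × ℤ))

instance smallCharFree [Module.Free ℤ M] : Module.Free ℤ (SmallChar P) :=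
  inferInstanceAs (Module.Free ℤ M)

instance bigCharFree [Module.Free ℤ M] : Module.Free ℤ (BigChar P) :=
  inferInstanceAs (Module.Free ℤ (M × ℤ))

instance smallCharFinite [Module.Finite ℤ M] : Module.Finite ℤ (SmallChar P) :=
  inferInstanceAs (Module.Finite ℤ M)

instance bigCharFinite [Module.Finite ℤ M] : Module.Finite ℤ (BigChar P) :=
  inferInstanceAs (Module.Finite ℤ (M × ℤ))

/-- The affine Weyl group acts on `T^*` through the finite Weyl group: `t_λ w (μ) = w(μ)`. -/
instance smallCharAction : DistribMulAction (AffineWeyl P) (SmallChar P) where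
  smul g μ := (g.right • (show M from μ) : M)
  one_smul μ := one_smul P.weylGroup (show M from μ)
  mul_smul g h μ := mul_smul g.right h.right (show M from μ)
  smul_zero g := smul_zero (A := M) g.right
  smul_add g := smul_add (A := M) g.right

/-- The action of the affine Weyl group on `T_a^* = T^* ⊕ ℤδ`:
`t_λ w (μ + m δ) = w(μ) + (m - ⟨w(μ), λ⟩) δ`. -/
def bigAct (g : AffineWeyl P) (p : M × ℤ) : M × ℤ :=
  (g.right • p.1, p.2 - P.toLinearMap (g.right • p.1) g.left.toAdd)

theorem bigAct_mul (g h : AffineWeyl P) (p : M × ℤ) :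
    bigAct P (g * h) p = bigAct P g (bigAct P h p) := by
  refine Prod.ext (mul_smul g.right h.right p.1) ?_
  simp only [bigAct, SemidirectProduct.mul_left, SemidirectProduct.mul_right, toAdd_mul, map_add,
    mul_smul, weylCoaction_pairing]
  ring

theorem bigAct_add (g : AffineWeyl P) (p q : M × ℤ) :
    bigAct P g (p + q) = bigAct P g p + bigAct P g q := by
  refine Prod.ext (smul_add _ _ _) ?_
  simp only [bigAct, Prod.fst_add, Prod.snd_add, smul_add, map_add, LinearMap.add_apply]
  ring

instance bigCharAction : DistribMulAction (AffineWeyl P) (BigChar P) where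
  smul g p := bigAct P g p
  one_smul p := Prod.ext (one_smul P.weylGroup (show M × ℤ from p).1) (by
    change (bigAct P 1 (show M × ℤ from p)).2 = (show M × ℤ from p).2
    simp [bigAct])
  mul_smul g h p := bigAct_mul P g h p
  smul_zero g := by
    change bigAct P g (0 : M × ℤ) = (0 : M × ℤ)
    simp [bigAct]
  smul_add g p q := by
    change bigAct P g ((show M × ℤ from p) + (show M × ℤ from q)) =
      bigAct P g (show M × ℤ from p) + bigAct P g (show M × ℤ from q)
    exact bigAct_add P g _ _

/-- The roots `Φ`, as characters of the small torus. -/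
def smallRoots : Set (SmallChar P) := Set.range fun i => (P.root i : M)

/-- The real affine roots `Φ_a = {α + m δ | α ∈ Φ, m ∈ ℤ}`, as characters of the big torus. -/
def bigRoots : Set (BigChar P) := Set.range fun q : ι × ℤ => ((P.root q.1, q.2) : M × ℤ)

theorem smul_smallRoots (g : AffineWeyl P) (μ : SmallChar P) (hμ : μ ∈ smallRoots P) :
    g • μ ∈ smallRoots P := by
  obtain ⟨i, rfl⟩ := hμ
  exact ⟨P.weylGroupToPerm g.right i, (P.weylGroup_apply_root g.right i).symm⟩

theorem smul_bigRoots (g : AffineWeyl P) (μ : BigChar P) (hμ : μ ∈ bigRoots P) :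
    g • μ ∈ bigRoots P := by
  obtain ⟨⟨i, m⟩, rfl⟩ := hμ
  exact ⟨(P.weylGroupToPerm g.right i, m - P.toLinearMap (g.right • P.root i) g.left.toAdd),
    Prod.ext (P.weylGroup_apply_root g.right i).symm rfl⟩

theorem root_reflectionPerm_self (i : ι) : P.root (P.reflectionPerm i i) = -P.root i := by simp

variable {P} (b : P.Base) (θ : ι)

/-- `θ` is (the index of) the highest root: `θ - β` is a sum of simple roots for every root `β`. -/
def IsHighestRoot : Prop :=
  ∀ i, P.root θ - P.root i ∈ AddSubmonoid.closure (P.root '' (b.support : Set ι))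

/-- The simple affine reflections: `s_i` for a simple root `α_i`, and for the extra node
`s_0 = s_{-θ+δ} = s_θ t_{-θ^∨}`. -/
def simpleReflection : Option b.support → AffineWeyl P
  | some i => SemidirectProduct.inr (RootPairing.weylGroup.ofIdx P i)
  | none => SemidirectProduct.inr (RootPairing.weylGroup.ofIdx P θ) *
      SemidirectProduct.inl (Multiplicative.ofAdd (-P.coroot θ))

/-- The simple affine roots `α_i` and `α_0 = -θ + δ`, as characters of the big torus. -/
def bigSimple : Option b.support → bigRoots P
  | some i => ⟨((P.root i, 0) : M × ℤ), ⟨(i, 0), rfl⟩⟩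
  | none => ⟨((-P.root θ, 1) : M × ℤ), ⟨(P.reflectionPerm θ θ, 1), Prod.ext (root_reflectionPerm_self P θ) rfl⟩⟩

/-- Their restrictions `α_i` and `-θ` to the small torus. -/
def smallSimple : Option b.support → smallRoots P
  | some i => ⟨(P.root i : M), ⟨i, rfl⟩⟩
  | none => ⟨(-P.root θ : M), ⟨P.reflectionPerm θ θ, root_reflectionPerm_self P θ⟩⟩

/-- `s_{α+mδ}(μ + nδ) = μ + nδ - ⟨μ, α^∨⟩(α + mδ)` for the simple affine root `α_0 = -θ + δ`. -/
theorem simpleReflection_none_smul (p : M × ℤ) :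
    bigAct P (simpleReflection b θ none) p =
      p + P.toLinearMap p.1 (P.coroot θ) • ((-P.root θ, 1) : M × ℤ) := by
  rw [simpleReflection, bigAct_mul]
  refine Prod.ext ?_ ?_
  · change RootPairing.weylGroup.ofIdx P θ • ((1 : P.weylGroup) • p.1) = _
    rw [one_smul, RootPairing.weylGroup.ofIdx_smul, RootPairing.Equiv.reflection_smul,
      RootPairing.reflection_apply]
    simp [sub_eq_add_neg]
  · simp [bigAct]

/-- The small torus model over a ring `A` with elements `x_μ`, `μ ∈ T^*`. -/
def smallModel {A : Type*} [CommRing A] [MulSemiringAction (AffineWeyl P) A]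
    (x : SmallChar P → A) (hx : ∀ (g : AffineWeyl P) (μ : SmallChar P), g • x μ = x (g • μ)) :
    Model (AffineWeyl P) (Option b.support) (SmallChar P) A where
  x := x
  smul_x := hx
  roots := smallRoots P
  smul_roots := smul_smallRoots P
  simple := smallSimple b θ
  refl := simpleReflection b θ

/-- The big torus model over a ring `A` with elements `x_μ`, `μ ∈ T_a^*`. -/
def bigModel {A : Type*} [CommRing A] [MulSemiringAction (AffineWeyl P) A]
    (x : BigChar P → A) (hx : ∀ (g : AffineWeyl P) (μ : BigChar P), g • x μ = x (g • μ)) :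
    Model (AffineWeyl P) (Option b.support) (BigChar P) A where
  x := x
  smul_x := hx
  roots := bigRoots P
  smul_roots := smul_bigRoots P
  simple := bigSimple b θ
  refl := simpleReflection b θ

variable {R : Type*} [CommRing R]

/-- The small torus, for the formal group law `F`, with `S` the power series version of the formal
group algebra of `T^*`. -/
def smallTorus [Module.Free ℤ M] [Module.Finite ℤ M] (F : FormalGroup R) [F.IsComm] :
    Model (AffineWeyl P) (Option b.support) (SmallChar P) (FormalGroupAlgebra F (SmallChar P)) :=
  smallModel b θ (chern F) (smul_chern F)

/-- The big torus, for the formal group law `F`, with the power series version of the formal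
group algebra of `T_a^*`. -/
def bigTorus [Module.Free ℤ M] [Module.Finite ℤ M] (F : FormalGroup R) [F.IsComm] :
    Model (AffineWeyl P) (Option b.support) (BigChar P) (FormalGroupAlgebra F (BigChar P)) :=
  bigModel b θ (chern F) (smul_chern F)

/-- The small torus, for the connective formal group law `x + y - c x y`, with `S` the polynomial
version of the formal group algebra of `T^*`. -/
def smallTorusConnective (c : R) :
    Model (AffineWeyl P) (Option b.support) (SmallChar P) (ConnectiveAlgebra c (SmallChar P)) :=
  smallModel b θ (connectiveChern c) (smul_connectiveChern c)

/-- The big torus, for the connective formal group law `x + y - c x y`, with the polynomial version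
of the formal group algebra of `T_a^*`. -/
def bigTorusConnective (c : R) :
    Model (AffineWeyl P) (Option b.support) (BigChar P) (ConnectiveAlgebra c (BigChar P)) :=
  bigModel b θ (connectiveChern c) (smul_connectiveChern c)

/-- A root datum is simple and simply connected: the root system is irreducible (nonempty, and not
the union of two nonempty mutually orthogonal subsets) and the coroots span the cocharacter
lattice. -/
structure IsSimpleSimplyConnected (P : RootPairing ι ℤ M N) : Prop where
  nonempty : Nonempty ι
  irreducible : ∀ s : Set ι, s.Nonempty → sᶜ.Nonempty → ∃ i ∈ s, ∃ j ∈ sᶜ, P.pairing i j ≠ 0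
  corootSpan_eq_top : P.corootSpan ℤ = ⊤

end Affine

end AffineFADA

end

noncomputable section

namespace AffineFADA

/-! ### Divisibility in power series rings -/

/-! Let `p = k ∘ pr`, the left `Q`-linear map `η_{t w} ↦ η_t` (`proj` below). Assertion 2 says that
`p` preserves `D = D_{W_a}`; assertion 1 follows by composing an integral form with `k`.

Small torus. Translations act trivially on `S`, so an element `y` supported on translations (`p y =
y`) commutes with `Q`. For a simple affine reflection `s = t w` with root `α` and Demazure element
`X`, `p (η_s y) = η_s y η_{w⁻¹}`, whence `p (X y) = X y + (s(x_α) / x_α) η_s y · (1 / x_α)(1 -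
η_{w⁻¹})`. Here `s(x_α) = x_{-α}` is a multiple of `x_α`, and the last factor lies in `D`: for `s_i`
it is `X_i`; for `s_0` it is an `S`-multiple of the divided difference of `θ`, which is reached from
the simple ones by conjugation with `η_{s_i} ∈ D` and changes of sign. Since `p (z w y) = p (z p(w
y))`, induction over products of generators, evaluated at `y = 1`, gives `p(D) ⊆ D`. The carriers
are `proj_divDiff_mul`, `proj_mul_mem` and `divDiff_root_mem`.

Big torus. Here `p X_0 = (1 / x_{α_0})(1 - η_{t_{θ^∨}})`. The algebra acts on the coefficient ring,
because each `s_j` is the identity modulo `x_{α_j}`. Were `p X_0` in it, `x_{α_0}` would divide `x_θ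
- x_{θ-2δ}`. The linear part of `x_μ` is `μ`, so `2δ` would be proportional to `-θ + δ`, which is
impossible in characteristic `0`. The carriers are `map_dvd_of_divDiff_mem` and
`map_eq_zero_of_chern_dvd_sub`. For the polynomial version the divisibility is first transported to
the power series ring, a domain in which no root gives zero. -/

theorem dvd_sub_of_zsmul {L A : Type*} [AddCommGroup L] [CommRing A] {x : L → A}
    (h : ∀ μ α, x α ∣ x (μ + α) - x μ) (μ α : L) (k : ℤ) : x α ∣ x (μ + k • α) - x μ := by
  induction k using Int.induction_on with
  | zero => simp
  | succ k ih =>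
    have := dvd_add (h (μ + (k : ℤ) • α) α) ih
    rwa [sub_add_sub_cancel, add_assoc, ← add_one_zsmul] at this
  | pred k ih =>
    have := dvd_sub ih (h (μ + (-(k : ℤ) - 1) • α) α)
    rwa [add_assoc, ← add_one_zsmul, sub_add_cancel, sub_sub_sub_cancel_left] at this

section Divisibility

open MvPowerSeries

variable {R : Type*} [CommRing R]

/-- Divisibility by a variable is a condition on individual coefficients, so the infinite sums
defining the two substitutions can be compared monomial by monomial. For a general divisor this is
not available; `dvd_subst_sub` reduces to this case. -/
theorem X_dvd_subst_sub {σ τ : Type*} {s : τ} {a b : σ → MvPowerSeries τ R}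
    (ha : HasSubst a) (hb : HasSubst b) (h : ∀ i, X s ∣ a i - b i) (p : MvPowerSeries σ R) :
    X s ∣ subst a p - subst b p := by
  rw [X_dvd_iff]
  intro e he
  rw [map_sub, sub_eq_zero, coeff_subst ha, coeff_subst hb]
  refine finsum_congr fun d => ?_
  congr 1
  rw [← sub_eq_zero, ← map_sub]
  refine X_dvd_iff.1 ?_ e he
  rw [← Ideal.mem_span_singleton, ← Ideal.Quotient.mk_eq_mk_iff_sub_mem]
  simp only [Finsupp.prod, map_prod, map_pow]
  refine Finset.prod_congr rfl fun i _ => ?_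
  rw [(Ideal.Quotient.mk_eq_mk_iff_sub_mem _ _).2 (Ideal.mem_span_singleton.2 (h i))]

/-- Substituting families congruent modulo `x` yields results congruent modulo `x`. -/
theorem dvd_subst_sub {σ τ : Type*} [Finite σ] {a b : σ → MvPowerSeries τ R}
    {x : MvPowerSeries τ R} (hx : constantCoeff x = 0) (hb : ∀ i, constantCoeff (b i) = 0)
    (h : ∀ i, x ∣ a i - b i) (p : MvPowerSeries σ R) :
    x ∣ subst a p - subst b p := by
  choose q hq using h
  -- Universal situation: with `a i = b i + x * q i`, the index `none` stands for `x`, `inl i` for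
  -- `b i`, and `inr i` for `q i` minus its constant term. The constant term is split off so that
  -- specialising these variables is a legitimate substitution.
  let X' : Option (σ ⊕ σ) → MvPowerSeries (Option (σ ⊕ σ)) R := X
  let A : σ → MvPowerSeries (Option (σ ⊕ σ)) R := fun i =>
    X' (some (.inl i)) + X' none * (C (constantCoeff (q i)) + X' (some (.inr i)))
  let B : σ → MvPowerSeries (Option (σ ⊕ σ)) R := fun i => X' (some (.inl i))
  have hA : HasSubst A := hasSubst_of_constantCoeff_zero fun i => by simp [A, X']
  have hB : HasSubst B := hasSubst_of_constantCoeff_zero fun i => by simp [B, X']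
  let u : Option (σ ⊕ σ) → MvPowerSeries τ R := fun o =>
    o.elim x (Sum.elim b fun i => q i - C (constantCoeff (q i)))
  have hu : HasSubst u := hasSubst_of_constantCoeff_zero fun o => by
    rcases o with _ | i | i <;> simp [u, hx, hb]
  have key := X_dvd_subst_sub (s := none) hA hB (fun i => ⟨_, add_sub_cancel_left _ _⟩) p
  have key' := map_dvd (substAlgHom (R := R) hu) key
  rw [map_sub, substAlgHom_apply, substAlgHom_apply, substAlgHom_apply, subst_X hu,
    subst_comp_subst_apply hA hu, subst_comp_subst_apply hB hu] at key'
  have hAa : (fun i => subst (R := R) u (A i)) = a := by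
    ext1 i
    have hC : subst (R := R) u (C (constantCoeff (q i))) = C (constantCoeff (q i)) := by simp
    simp only [A, X', subst_add hu, subst_mul hu, subst_X hu, hC]
    simp only [u, Option.elim_some, Option.elim_none, Sum.elim_inl, Sum.elim_inr]
    rw [add_sub_cancel, ← hq, add_sub_cancel]
  have hBb : (fun i => subst (R := R) u (B i)) = b := by
    ext1 i
    simp only [B, X', subst_X hu]
    simp [u]
  rwa [hAa, hBb] at key'

theorem coeff_single_one_mul {σ : Type*} {i : σ} {p q : MvPowerSeries σ R}
    (hp : constantCoeff p = 0) :
    coeff (Finsupp.single i 1) (p * q) = coeff (Finsupp.single i 1) p * constantCoeff q := by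
  classical
  rw [coeff_mul, Finsupp.antidiagonal_single]
  simp [Finset.Nat.antidiagonal_succ, hp]

theorem coeff_single_one_subst (F : FormalGroup R) {σ : Type*} {i : σ} {u v : MvPowerSeries σ R}
    (hu : constantCoeff u = 0) (hv : constantCoeff v = 0) :
    coeff (Finsupp.single i 1) (F.toPowerSeries.subst ![u, v]) =
      coeff (Finsupp.single i 1) u + coeff (Finsupp.single i 1) v := by
  have hs : HasSubst ![u, v] := hasSubst_of_constantCoeff_zero fun s => by
    fin_cases s
    · exact hu
    · exact hv
  obtain ⟨H, hH⟩ : ∃ H, F.toPowerSeries = X 0 + X 1 + H := ⟨_, (add_sub_cancel _ _).symm⟩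
  have h0 : coeff 0 H = 0 := by
    have := F.zero_constantCoeff
    rw [hH] at this
    simpa using this
  have h1 : coeff (Finsupp.single 0 1) H = 0 := by
    have := F.lin_coeff_X
    rw [hH] at this
    simpa [coeff_index_single_X] using this
  have h2 : coeff (Finsupp.single 1 1) H = 0 := by
    have := F.lin_coeff_Y
    rw [hH] at this
    simpa [coeff_index_single_X] using this
  -- `H` has neither constant nor linear terms, and a monomial of degree at least two becomes a
  -- product of two series without constant term, hence has no linear part.
  have key : coeff (Finsupp.single i 1) (H.subst ![u, v]) = 0 := by
    rw [coeff_subst hs]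
    refine finsum_eq_zero_of_forall_eq_zero fun d => ?_
    have hd : d = Finsupp.single 0 (d 0) + Finsupp.single 1 (d 1) := by
      ext s; fin_cases s <;> simp
    generalize d 0 = m at hd
    generalize d 1 = n at hd
    subst hd
    have e : (Finsupp.single 0 m + Finsupp.single 1 n : Fin 2 →₀ ℕ).prod
        (fun s e => ![u, v] s ^ e) = u ^ m * v ^ n := by
      simp [Finsupp.prod_fintype]
    rw [e]
    rcases m with _ | m
    · rcases n with _ | _ | n
      · simp [h0]
      · simp [h2]
      · rw [pow_zero, one_mul, pow_succ', coeff_single_one_mul hv]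
        simp [hv]
    · rw [pow_succ', mul_assoc, coeff_single_one_mul hu]
      rcases m with _ | m
      · rcases n with _ | n
        · simp [h1]
        · simp [hv]
      · simp [hu]
  rw [hH, subst_add hs, subst_add hs, subst_X hs, subst_X hs]
  simp [key]

end Divisibility

/-! ### Linear parts of the `x_μ` and congruences modulo `x_α` -/

section FormalGroupAlgebra

open MvPowerSeries

variable {R : Type*} [CommRing R] [IsReduced R] (F : FormalGroup R) [F.IsComm]
variable {L : Type*} [AddCommGroup L] [Module.Free ℤ L]

theorem constantCoeff_chernSeries (μ : L) : constantCoeff (chernSeries F μ) = 0 :=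
  (show IsNilpotent (constantCoeff (chernSeries F μ)) from
    Subtype.property (chernPoint F L μ)).eq_zero

/-- Both sides are additive in `μ`, because `F` is `x + y` to first order, and they agree on the
chosen basis. -/
theorem coeff_chernSeries (i : Module.Free.ChooseBasisIndex ℤ L) (μ : L) :
    coeff (Finsupp.single i 1) (chernSeries F μ) =
      ((Module.Free.chooseBasis ℤ L).repr μ i : R) := by
  classical
  let φ : L →+ R := AddMonoidHom.mk' (fun μ => coeff (Finsupp.single i 1) (chernSeries F μ))
    fun μ ν => by
      rw [chernSeries_add, coeff_single_one_subst F (constantCoeff_chernSeries F μ)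
        (constantCoeff_chernSeries F ν)]
  let ψ : L →+ R := (Int.castAddHom R).comp
    ((Finsupp.applyAddHom i).comp (Module.Free.chooseBasis ℤ L).repr.toAddEquiv.toAddMonoidHom)
  have : φ = ψ := by
    apply AddMonoidHom.toIntLinearMap_injective
    refine (Module.Free.chooseBasis ℤ L).ext fun j => ?_
    change coeff (Finsupp.single i 1) (chernSeries F (Module.Free.chooseBasis ℤ L j)) =
      ((Module.Free.chooseBasis ℤ L).repr (Module.Free.chooseBasis ℤ L j) i : R)
    rw [chernSeries_basis, Module.Basis.repr_self, coeff_X, Finsupp.single_apply]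
    by_cases h : j = i
    · simp [h]
    · rw [if_neg, if_neg h, Int.cast_zero]
      rw [Finsupp.single_left_inj one_ne_zero]
      exact Ne.symm h
  exact DFunLike.congr_fun this μ

variable [Module.Finite ℤ L]

/-- Modulo `x_α`, `F(x_μ, x_α)` agrees with `F(x_μ, x_0) = x_μ`. -/
theorem chern_dvd_chern_add_sub (μ α : L) :
    chern F α ∣ chern F (μ + α) - chern F μ := by
  have h := dvd_subst_sub (a := ![chernSeries F μ, chernSeries F α])
    (b := ![chernSeries F μ, chernSeries F 0]) (x := chernSeries F α)
    (constantCoeff_chernSeries F α)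
    (fun i => by fin_cases i <;> exact constantCoeff_chernSeries F _)
    (fun i => by fin_cases i <;> simp [chernSeries_zero]) F.toPowerSeries
  rw [← chernSeries_add, ← chernSeries_add, add_zero] at h
  exact h

/-- The action of `g` substitutes `x_{g e_i}` for `x_{e_i}`, and these agree modulo `x_α`. Applied
to reflections, this makes the Demazure operators preserve the formal group algebra. -/
theorem chern_dvd_smul_sub {Γ : Type*} [Group Γ] [DistribMulAction Γ L] {g : Γ} {α : L}
    (h : ∀ μ, ∃ k : ℤ, g • μ = μ + k • α) (p : FormalGroupAlgebra F L) :
    chern F α ∣ g • p - p := by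
  have key := dvd_subst_sub (x := chernSeries F α)
    (a := fun i => chernSeries F (g • Module.Free.chooseBasis ℤ L i))
    (b := fun i => chernSeries F (Module.Free.chooseBasis ℤ L i))
    (constantCoeff_chernSeries F α) (fun i => constantCoeff_chernSeries F _) (fun i => by
      obtain ⟨k, hk⟩ := h (Module.Free.chooseBasis ℤ L i)
      rw [hk]
      exact dvd_sub_of_zsmul (chern_dvd_chern_add_sub F) _ α k) p
  have e : subst (R := R) (fun i => chernSeries F (Module.Free.chooseBasis ℤ L i)) p = p :=
    (inducedHom_apply F (AddMonoidHom.id L) p).symm.trans (inducedHom_id F p)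
  have e' : g • p =
      subst (R := R) (fun i => chernSeries F (g • Module.Free.chooseBasis ℤ L i)) p :=
    inducedHom_apply F (DistribSMul.toAddMonoidHom L g) p
  rw [e, ← e'] at key
  exact key

variable [CharZero R]

theorem chern_ne_zero {μ : L} (hμ : μ ≠ 0) : chern F μ ≠ 0 := by
  intro h
  refine hμ ((Module.Free.chooseBasis ℤ L).ext_elem fun i => ?_)
  have h' := coeff_chernSeries F i μ
  rw [show chernSeries F μ = 0 from h, map_zero] at h'
  simpa using h'.symm

/-- The linear part of a multiple of `x_α` is proportional to `α`. -/
theorem map_eq_zero_of_chern_dvd_sub {f : L →+ ℤ} {α μ ν : L} (hf : f α = 0)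
    (h : chern F α ∣ chern F μ - chern F ν) : f μ = f ν := by
  obtain ⟨q, hq⟩ := h
  let e := Module.Free.chooseBasis ℤ L
  have hsum (μ : L) : f μ = ∑ i, e.repr μ i * f (e i) := by
    conv_lhs => rw [← e.sum_repr μ]
    simp only [map_sum, map_zsmul, smul_eq_mul]
  -- Coordinate `i` of the linear part of `x_μ - x_ν = x_α q`: only the constant term of `q`
  -- contributes. Pairing these coordinates with `f` then gives `f μ - f ν = f α · q(0)`.
  have hc (i) : (e.repr μ i : R) - e.repr ν i =
      e.repr α i * constantCoeff (show MvPowerSeries _ R from q) := by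
    have := congrArg (coeff (Finsupp.single i 1)) (show chernSeries F μ - chernSeries F ν =
      chernSeries F α * (show MvPowerSeries _ R from q) from hq)
    have h1 : coeff (Finsupp.single i 1) (chernSeries F α * (show MvPowerSeries _ R from q)) = _ :=
      coeff_single_one_mul (constantCoeff_chernSeries F α)
    refine Eq.trans ?_ (this.trans (h1.trans ?_))
    · rw [← coeff_chernSeries F, ← coeff_chernSeries F, ← map_sub]
    · rw [coeff_chernSeries]
  have : (f μ : R) - f ν = f α * constantCoeff (show MvPowerSeries _ R from q) := by
    rw [hsum μ, hsum ν, hsum α]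
    push_cast
    rw [Finset.sum_mul, ← Finset.sum_sub_distrib]
    refine Finset.sum_congr rfl fun i _ => ?_
    rw [← sub_mul, hc]
    ring
  rw [hf, Int.cast_zero, zero_mul, sub_eq_zero] at this
  exact_mod_cast this

end FormalGroupAlgebra

/-! ### The connective formal group law -/

section Connective

open MvPowerSeries

variable {R : Type*} [CommRing R] (c : R)

/-- The connective formal group law `x + y - c x y`. -/
def connectiveGroup : FormalGroup R where
  toPowerSeries := X 0 + X 1 - C c * (X 0 * X 1)
  zero_constantCoeff := by simp
  lin_coeff_X := by
    rw [map_sub, coeff_C_mul, coeff_single_one_mul (by simp)]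
    simp [coeff_index_single_X]
  lin_coeff_Y := by
    rw [map_sub, coeff_C_mul, coeff_single_one_mul (by simp)]
    simp [coeff_index_single_X]
  assoc := by
    have h₁ := HasSubst.cons_subst_zero_left (f := X 0 + X 1 - C c * (X 0 * X 1))
      (0 : Fin 3) 1 2 (by simp)
    have h₂ := HasSubst.cons_subst_zero_right (f := X 0 + X 1 - C c * (X 0 * X 1))
      (0 : Fin 3) 1 2 (by simp)
    simp_rw [subst_sub h₁, subst_add h₁, subst_mul h₁, subst_C, subst_X h₁, subst_sub h₂,
      subst_add h₂, subst_mul h₂, subst_C, subst_X h₂]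
    simp only [subst_sub .X_X, subst_add .X_X, subst_mul .X_X, subst_X .X_X,
      subst_C, Matrix.cons_val_zero, Matrix.cons_val_one]
    ring

theorem connectiveGroup_subst {σ : Type*} {u v : MvPowerSeries σ R} (h : HasSubst ![u, v]) :
    (connectiveGroup c).toPowerSeries.subst ![u, v] = u + v - C c * (u * v) := by
  simp only [connectiveGroup, subst_sub h, subst_add h, subst_mul h, subst_X h, subst_C,
    Matrix.cons_val_zero, Matrix.cons_val_one]

instance connectiveGroupIsComm : (connectiveGroup c).IsComm where
  comm := by
    rw [connectiveGroup_subst c .X_X, connectiveGroup]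
    ring

theorem connectiveChern_zero {L : Type*} [AddCommGroup L] : connectiveChern c (0 : L) = 0 :=
  Ideal.Quotient.eq_zero_iff_mem.2 (Ideal.subset_span (Or.inl rfl))

theorem connectiveChern_add {L : Type*} [AddCommGroup L] (μ ν : L) :
    connectiveChern c (μ + ν) = connectiveChern c μ + connectiveChern c ν -
      Ideal.Quotient.mk (connectiveIdeal c L) (MvPolynomial.C c) *
        (connectiveChern c μ * connectiveChern c ν) := by
  rw [← sub_eq_zero]
  exact Ideal.Quotient.eq_zero_iff_mem.2 (Ideal.subset_span (Or.inr ⟨(μ, ν), rfl⟩))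

theorem connectiveChern_dvd_add_sub {L : Type*} [AddCommGroup L] (μ α : L) :
    connectiveChern c α ∣ connectiveChern c (μ + α) - connectiveChern c μ := by
  rw [connectiveChern_add]
  exact ⟨1 - Ideal.Quotient.mk (connectiveIdeal c L) (MvPolynomial.C c) * connectiveChern c μ,
    by ring⟩

theorem connectiveChern_dvd_smul_sub {L : Type*} [AddCommGroup L] {Γ : Type*} [Group Γ]
    [DistribMulAction Γ L] {g : Γ} {α : L} (h : ∀ μ, ∃ k : ℤ, g • μ = μ + k • α)
    (p : ConnectiveAlgebra c L) : connectiveChern c α ∣ g • p - p := by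
  obtain ⟨p, rfl⟩ := Ideal.Quotient.mk_surjective p
  induction p using MvPolynomial.induction_on with
  | C r =>
    have : g • Ideal.Quotient.mk (connectiveIdeal c L) (MvPolynomial.C r) =
        Ideal.Quotient.mk (connectiveIdeal c L) (MvPolynomial.C r) := by
      change connectiveHom c (DistribSMul.toAddMonoidHom L g) _ = _
      rw [connectiveHom_mk, MvPolynomial.rename_C]
    simp [this]
  | add p q hp hq =>
    rw [map_add, smul_add, add_sub_add_comm]
    exact dvd_add hp hq
  | mul_X p μ hp =>
    obtain ⟨k, hk⟩ := h μ
    have := dvd_sub_of_zsmul (connectiveChern_dvd_add_sub c) μ α k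
    rw [map_mul, smul_mul']
    change _ ∣ _ * g • connectiveChern c μ - _ * connectiveChern c μ
    rw [smul_connectiveChern, hk]
    generalize connectiveChern c (μ + k • α) = y at this
    rw [show ∀ u v w z : ConnectiveAlgebra c L, u * z - v * w = (u - v) * z + v * (z - w) by
      intros; ring]
    exact dvd_add (hp.mul_right _) (this.mul_left _)

variable {L : Type*} [AddCommGroup L] [Module.Free ℤ L]

/-- The comparison of the polynomial and the power series version of the formal group algebra. -/
def connectiveToSeries :
    ConnectiveAlgebra c L →+* MvPowerSeries (Module.Free.ChooseBasisIndex ℤ L) R :=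
  Ideal.Quotient.lift (connectiveIdeal c L)
    (MvPolynomial.eval₂Hom (C : R →+* MvPowerSeries (Module.Free.ChooseBasisIndex ℤ L) R)
      (chernSeries (connectiveGroup c))) (fun p hp => by
    refine (Ideal.span_le (I := RingHom.ker _)).2 ?_ hp
    rintro _ (rfl | ⟨⟨μ, ν⟩, rfl⟩)
    · simp [chernSeries_zero]
    · have h : HasSubst ![chernSeries (connectiveGroup c) μ, chernSeries (connectiveGroup c) ν] :=
        hasSubst_of_constantCoeff_nilpotent fun s => by
          fin_cases s <;> exact Subtype.property (chernPoint (connectiveGroup c) L _)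
      simp [chernSeries_add, connectiveGroup_subst c h])

theorem connectiveToSeries_chern (μ : L) :
    connectiveToSeries c (connectiveChern c μ) = chernSeries (connectiveGroup c) μ :=
  (Ideal.Quotient.lift_mk _ _ _).trans (MvPolynomial.eval₂Hom_X' _ _ _)

end Connective

namespace Model

/-! ### Computations in the twisted group algebra -/

section General

variable {Γ J L A : Type*} [Group Γ] [AddCommGroup L] [DistribMulAction Γ L] [CommRing A]
  [MulSemiringAction Γ A] (T : Model Γ J L A)

/-- The embedding of `Q` into the twisted group algebra. -/
def scalar : T.Q →+* T.Twisted := SkewMonoidAlgebra.singleOneRingHom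

theorem scalar_apply (q : T.Q) : T.scalar q = SkewMonoidAlgebra.single 1 q := rfl

theorem scalar_algebraMap (a : A) : T.scalar (algebraMap A T.Q a) = T.coeff a := rfl

theorem smul_eq_scalar_mul (q : T.Q) (z : T.Twisted) : q • z = T.scalar q * z := by
  ext g
  rw [scalar_apply, SkewMonoidAlgebra.coeff_single_one_mul, SkewMonoidAlgebra.coeff_smul,
    Finsupp.smul_apply, smul_eq_mul]

theorem η_mul (g h : Γ) : T.η g * T.η h = T.η (g * h) := by
  rw [η, η, η, SkewMonoidAlgebra.single_mul_single, smul_one, one_mul]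

theorem η_one : T.η 1 = 1 := rfl

theorem single_eq (g : Γ) (q : T.Q) : SkewMonoidAlgebra.single g q = T.scalar q * T.η g := by
  rw [scalar_apply, η, SkewMonoidAlgebra.single_mul_single, one_mul, one_smul, mul_one]

theorem η_mul_scalar (g : Γ) (q : T.Q) : T.η g * T.scalar q = T.scalar (g • q) * T.η g := by
  rw [← single_eq, scalar_apply, η, SkewMonoidAlgebra.single_mul_single, mul_one, one_mul]

theorem invX_mul (α : T.roots) : T.invX α * algebraMap A T.Q (T.x α) = 1 := by
  rw [invX, Localization.mk_eq_mk']
  exact IsLocalization.mk'_spec T.Q 1 _ |>.trans (map_one _)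

theorem smul_invX (g : Γ) (α β : T.roots) (h : g • (α : L) = β) : g • T.invX α = T.invX β := by
  have e : T.invX β * (g • T.invX α * algebraMap A T.Q (T.x β)) = T.invX β := by
    rw [← h, ← T.smul_x, ← T.smul_algebraMap, ← smul_mul', invX_mul, smul_one, mul_one]
  rwa [mul_left_comm, invX_mul, mul_one] at e

/-- The element `(1 / x_α)(1 - η_g)`. -/
def divDiff (α : T.roots) (g : Γ) : T.Twisted := T.scalar (T.invX α) * (1 - T.η g)

theorem demazure_eq (j : J) : T.demazure j = T.divDiff (T.simple j) (T.refl j) :=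
  T.smul_eq_scalar_mul _ _

theorem demazure_mem (j : J) : T.divDiff (T.simple j) (T.refl j) ∈ T.fadaSubring :=
  T.demazure_eq j ▸ Subring.subset_closure (Or.inr ⟨j, rfl⟩)

theorem coeff_mem (a : A) : T.coeff a ∈ T.fadaSubring :=
  Subring.subset_closure (Or.inl ⟨a, rfl⟩)

theorem coeff_mul_divDiff (α : T.roots) (g : Γ) :
    T.coeff (T.x α) * T.divDiff α g = 1 - T.η g := by
  rw [divDiff, ← scalar_algebraMap, ← mul_assoc, ← map_mul, mul_comm _ (T.invX α), invX_mul,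
    map_one, one_mul]

theorem η_refl_mem (j : J) : T.η (T.refl j) ∈ T.fadaSubring := by
  rw [← sub_sub_cancel 1 (T.η (T.refl j)), ← T.coeff_mul_divDiff (T.simple j)]
  exact sub_mem (one_mem _) (mul_mem (T.coeff_mem _) (T.demazure_mem j))

theorem scalar_invX_mul_algebraMap_mem {α : T.roots} {a : A} (h : T.x α ∣ a) :
    T.scalar (T.invX α * algebraMap A T.Q a) ∈ T.fadaSubring := by
  obtain ⟨b, rfl⟩ := h
  rw [map_mul (algebraMap A T.Q), ← mul_assoc, invX_mul, one_mul]
  exact T.coeff_mem b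

/-- The action of the twisted group algebra on `Q`. -/
def act : T.Twisted →+* AddMonoid.End T.Q :=
  SkewMonoidAlgebra.liftNCRingHom (Module.toAddMonoidEnd T.Q T.Q)
    (DistribMulAction.toAddMonoidEnd Γ T.Q) (by
      intro q g
      ext r
      exact (smul_mul' g q r).symm)

theorem act_scalar (q r : T.Q) : T.act (T.scalar q) r = q * r := by
  change T.act (SkewMonoidAlgebra.single 1 q) r = _
  refine (DFunLike.congr_fun (SkewMonoidAlgebra.liftNC_single _ _ _ _) r).trans ?_
  change q • ((1 : Γ) • r) = q * r
  rw [one_smul, smul_eq_mul]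

theorem act_η (g : Γ) (r : T.Q) : T.act (T.η g) r = g • r := by
  refine (DFunLike.congr_fun (SkewMonoidAlgebra.liftNC_single _ _ _ _) r).trans ?_
  change (1 : T.Q) • (g • r) = g • r
  rw [one_smul]

theorem act_divDiff (α : T.roots) (g : Γ) (r : T.Q) :
    T.act (T.divDiff α g) r = T.invX α * (r - g • r) := by
  rw [divDiff, map_mul, map_sub, map_one]
  change T.act (T.scalar _) (r - T.act (T.η g) r) = _
  rw [act_scalar, act_η]

variable {T}

/-- The formal affine Demazure algebra acts on `A`. -/
theorem act_algebraMap_mem_range (hT : ∀ j a, T.x (T.simple j) ∣ T.refl j • a - a)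
    {z : T.Twisted} (hz : z ∈ T.fadaSubring) :
    ∀ a : A, T.act z (algebraMap A T.Q a) ∈ (algebraMap A T.Q).range := by
  have hneg (z : T.Twisted) (q : T.Q) : T.act (-z) q = -T.act z q := by rw [map_neg]; rfl
  induction hz using Subring.closure_induction with
  | mem z hz =>
    rintro a
    rcases hz with ⟨b, rfl⟩ | ⟨j, rfl⟩
    · rw [← scalar_algebraMap, act_scalar, ← map_mul]
      exact ⟨_, rfl⟩
    · obtain ⟨b, hb⟩ := hT j a
      rw [demazure_eq, act_divDiff, smul_algebraMap, ← map_sub, ← neg_sub, hb, ← mul_neg, map_mul,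
        ← mul_assoc, invX_mul, one_mul]
      exact ⟨_, rfl⟩
  | zero =>
    intro a
    rw [map_zero]
    exact zero_mem _
  | one =>
    intro a
    rw [map_one]
    exact ⟨a, rfl⟩
  | add z w _ _ hz hw =>
    intro a
    rw [map_add]
    exact add_mem (hz a) (hw a)
  | neg z _ hz => exact fun a => hneg z _ ▸ neg_mem (hz a)
  | mul z w _ _ hz hw =>
    intro a
    obtain ⟨b, hb⟩ := hw a
    rw [map_mul]
    change T.act z (T.act w _) ∈ _
    rw [← hb]
    exact hz b

/-- Applying the element to `a` gives a divisibility in `Q`. Since `A → Q` is not assumed injective,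
it descends to `A` only after multiplication by a denominator. -/
theorem exists_denom_of_divDiff_mem (hT : ∀ j a, T.x (T.simple j) ∣ T.refl j • a - a)
    {α : T.roots} {g : Γ} (h : T.divDiff α g ∈ T.fadaSubring) (a : A) :
    ∃ d ∈ T.denom, ∃ b, d * (a - g • a) = d * (T.x α * b) := by
  obtain ⟨b, hb⟩ := act_algebraMap_mem_range hT h a
  rw [act_divDiff, smul_algebraMap, ← map_sub] at hb
  have : algebraMap A T.Q (a - g • a) = algebraMap A T.Q (T.x α * b) := by
    rw [map_mul, hb, ← mul_assoc, mul_comm _ (T.invX α), invX_mul, one_mul]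
  obtain ⟨d, hd⟩ := (IsLocalization.eq_iff_exists T.denom T.Q).1 this
  exact ⟨d, d.2, b, hd⟩

/-- If `(1 / x_α)(1 - η_g)` lies in the formal affine Demazure algebra, then `x_α` divides
`a - g(a)` after base change to a domain in which the roots do not vanish. -/
theorem map_dvd_of_divDiff_mem (hT : ∀ j a, T.x (T.simple j) ∣ T.refl j • a - a)
    {B : Type*} [CommRing B] [IsDomain B] (ψ : A →+* B) (hψ : ∀ μ ∈ T.roots, ψ (T.x μ) ≠ 0)
    {α : T.roots} {g : Γ} (h : T.divDiff α g ∈ T.fadaSubring) (a : A) :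
    ψ (T.x α) ∣ ψ (a - g • a) := by
  obtain ⟨d, hd, b, e⟩ := exists_denom_of_divDiff_mem hT h a
  have hd' : T.denom ≤ (nonZeroDivisors B).comap ψ := by
    refine Submonoid.closure_le.2 ?_
    rintro _ ⟨μ, hμ, rfl⟩
    exact mem_nonZeroDivisors_of_ne_zero (hψ μ hμ)
  refine ⟨ψ b, ?_⟩
  rw [← map_mul]
  refine mul_left_cancel₀ (nonZeroDivisors.ne_zero (hd' hd)) ?_
  rw [← map_mul, ← map_mul, e]

end General

/-! ### The projection onto translations, and stability of the Demazure algebra under it -/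

section Semidirect

variable {H G J L A : Type*} [Group H] [Group G] {ρ : G →* MulAut H} [AddCommGroup L]
  [DistribMulAction (H ⋊[ρ] G) L] [CommRing A] [MulSemiringAction (H ⋊[ρ] G) A]
  (T : Model (H ⋊[ρ] G) J L A)

/-- The left `Q`-linear map `η_{t w} ↦ η_t` on the twisted group algebra. -/
def proj : T.Twisted →ₗ[T.Q] T.Twisted := T.k ∘ₗ T.pr

theorem proj_single (g : H ⋊[ρ] G) (c : T.Q) : T.proj (SkewMonoidAlgebra.single g c) =
    SkewMonoidAlgebra.single (SemidirectProduct.inl g.left) c := by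
  rw [proj, LinearMap.comp_apply, pr_single, k_single]

theorem proj_scalar_mul (q : T.Q) (z : T.Twisted) :
    T.proj (T.scalar q * z) = T.scalar q * T.proj z := by
  rw [← smul_eq_scalar_mul, map_smul, smul_eq_scalar_mul]

theorem proj_η (g : H ⋊[ρ] G) : T.proj (T.η g) = T.η (SemidirectProduct.inl g.left) :=
  T.proj_single g 1

theorem proj_one : T.proj 1 = 1 := T.proj_η 1

theorem proj_proj (z : T.Twisted) : T.proj (T.proj z) = T.proj z := by
  induction z using SkewMonoidAlgebra.induction_on with
  | zero => simp
  | single g c => rw [proj_single, proj_single, SemidirectProduct.left_inl]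
  | add z w hz hw => simp [hz, hw]

/-- The left component of `g h` does not depend on the right component of `h`. This lets an
induction on products replace the right factor by its projection. -/
theorem proj_mul_proj (z w : T.Twisted) : T.proj (z * T.proj w) = T.proj (z * w) := by
  induction z using SkewMonoidAlgebra.induction_on with
  | zero => simp
  | add z z' hz hz' => simp [add_mul, hz, hz']
  | single g c =>
    induction w using SkewMonoidAlgebra.induction_on with
    | zero => simp
    | add w w' hw hw' => simp [mul_add, hw, hw']
    | single h d =>
      rw [proj_single, SkewMonoidAlgebra.single_mul_single, SkewMonoidAlgebra.single_mul_single,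
        proj_single, proj_single, SemidirectProduct.mul_left, SemidirectProduct.mul_left,
        SemidirectProduct.left_inl]

theorem inl_left_eq (g : H ⋊[ρ] G) :
    SemidirectProduct.inl g.left = g * (SemidirectProduct.inr g.right)⁻¹ := by
  rw [eq_mul_inv_iff_mul_eq, SemidirectProduct.inl_left_mul_inr_right]

variable {T}

/-- For every `t ∈ H` the element `g t` has the same right component as `g`, so deleting it is one
right multiplication, the same for all terms of `y`. -/
theorem proj_η_mul (g : H ⋊[ρ] G) {y : T.Twisted} (hy : T.proj y = y) :
    T.proj (T.η g * y) = T.η g * y * T.η (SemidirectProduct.inr g.right)⁻¹ := by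
  rw [← hy]
  generalize y = w
  induction w using SkewMonoidAlgebra.induction_on with
  | zero => simp
  | add w w' hw hw' => simp [mul_add, add_mul, hw, hw']
  | single h d =>
    rw [proj_single, η, η, SkewMonoidAlgebra.single_mul_single,
      SkewMonoidAlgebra.single_mul_single, proj_single, inl_left_eq]
    simp

/-- This is where the small torus enters: the normal subgroup acts trivially on `Q`. For the big
torus translations move `δ`-components and the hypothesis `hH` is not available. -/
theorem scalar_mul_comm (hH : ∀ (h : H) (q : T.Q), (SemidirectProduct.inl h : H ⋊[ρ] G) • q = q)
    {y : T.Twisted} (hy : T.proj y = y) (q : T.Q) : T.scalar q * y = y * T.scalar q := by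
  rw [← hy]
  generalize y = w
  induction w using SkewMonoidAlgebra.induction_on with
  | zero => simp
  | add w w' hw hw' => simp [mul_add, add_mul, hw, hw']
  | single h d =>
    rw [proj_single, single_eq, mul_assoc _ _ (T.scalar q), η_mul_scalar, hH, ← mul_assoc,
      ← mul_assoc, ← map_mul, ← map_mul, mul_comm]

/-- Write `y - η_g y η_{w⁻¹} = (y - η_g y) + η_g y (1 - η_{w⁻¹})`, with `w` the right component of
`g`. The second bracket is `x_α` times a divided difference, and `x_α` passes leftwards through `y`
unchanged and through `η_g` as `g(x_α)`. -/
theorem proj_divDiff_mul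
    (hH : ∀ (h : H) (q : T.Q), (SemidirectProduct.inl h : H ⋊[ρ] G) • q = q)
    (α : T.roots) (g : H ⋊[ρ] G) {y : T.Twisted} (hy : T.proj y = y) :
    T.proj (T.divDiff α g * y) = T.divDiff α g * y +
      T.scalar (T.invX α * algebraMap A T.Q (g • T.x α)) *
        (T.η g * y * T.divDiff α (SemidirectProduct.inr g.right)⁻¹) := by
  have e : T.scalar (algebraMap A T.Q (g • T.x α)) * (T.η g * y * T.scalar (T.invX α)) =
      T.η g * y := by
    rw [mul_assoc, ← scalar_mul_comm hH hy, ← mul_assoc, ← mul_assoc, ← smul_algebraMap,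
      ← η_mul_scalar, mul_assoc (T.η g), ← map_mul, mul_comm (algebraMap A T.Q _), invX_mul,
      map_one, mul_one]
  conv_rhs => rw [map_mul, mul_assoc, divDiff, divDiff, ← mul_assoc (T.η g * y),
    ← mul_assoc (T.scalar (algebraMap A T.Q _)), e]
  rw [divDiff, mul_assoc, proj_scalar_mul, sub_mul, one_mul, map_sub, hy, proj_η_mul g hy]
  have key {S : Type _} [Ring S] (u n y w : S) :
      u * (y - n * y * w) = u * (y - n * y) + u * (n * y * (1 - w)) := by
    noncomm_ring
  exact key (S := T.Twisted) _ _ _ _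

/-- The induction on `z` must run over all projection-fixed `y` at once: in a product `z w`, the
statement for `z` is applied to the new element `proj (w * y)`. The case `y = 1` is the one wanted.
-/
theorem proj_mul_mem (hH : ∀ (h : H) (q : T.Q), (SemidirectProduct.inl h : H ⋊[ρ] G) • q = q)
    (hx : ∀ j, T.x (T.simple j) ∣ T.refl j • T.x (T.simple j))
    (hr : ∀ j, T.divDiff (T.simple j) (SemidirectProduct.inr (T.refl j).right)⁻¹ ∈ T.fadaSubring)
    {z : T.Twisted} (hz : z ∈ T.fadaSubring) :
    ∀ y ∈ T.fadaSubring, T.proj y = y → T.proj (z * y) ∈ T.fadaSubring := by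
  induction hz using Subring.closure_induction with
  | mem z hz =>
    rintro y hy hy'
    rcases hz with ⟨b, rfl⟩ | ⟨j, rfl⟩
    · rw [← scalar_algebraMap, proj_scalar_mul, hy']
      exact mul_mem (T.coeff_mem b) hy
    · rw [demazure_eq, proj_divDiff_mul hH _ _ hy']
      exact add_mem (mul_mem (T.demazure_mem j) hy)
        (mul_mem (T.scalar_invX_mul_algebraMap_mem (hx j))
          (mul_mem (mul_mem (T.η_refl_mem j) hy) (hr j)))
  | zero =>
    intro y _ _
    rw [zero_mul, map_zero]
    exact zero_mem _
  | one =>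
    intro y hy hy'
    rwa [one_mul, hy']
  | add z w _ _ hz hw =>
    intro y hy hy'
    rw [add_mul, map_add]
    exact add_mem (hz y hy hy') (hw y hy hy')
  | neg z _ hz =>
    intro y hy hy'
    rw [show -z * y = -(z * y) from neg_mul z y, map_neg]
    exact neg_mem (hz y hy hy')
  | mul z w _ _ hz hw =>
    intro y hy hy'
    rw [mul_assoc, ← proj_mul_proj]
    exact hz _ (hw y hy hy') (T.proj_proj _)

theorem k_mem_fada (hH : ∀ (h : H) (q : T.Q), (SemidirectProduct.inl h : H ⋊[ρ] G) • q = q)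
    (hx : ∀ j, T.x (T.simple j) ∣ T.refl j • T.x (T.simple j))
    (hr : ∀ j, T.divDiff (T.simple j) (SemidirectProduct.inr (T.refl j).right)⁻¹ ∈ T.fadaSubring) :
    ∀ z ∈ T.relFada, T.k z ∈ T.fada := by
  rintro _ ⟨z, hz, rfl⟩
  have := proj_mul_mem hH hx hr hz 1 (one_mem _) T.proj_one
  rwa [mul_one] at this

theorem kDual_mem_integralDual (h : ∀ z ∈ T.relFada, T.k z ∈ T.fada) :
    ∀ f ∈ T.integralDual T.fada, T.kDual f ∈ T.integralDual T.relFada := by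
  rintro f ⟨φ, hφ⟩
  exact ⟨φ ∘ₗ (T.k.restrictScalars A).restrict h, fun z => hφ ⟨T.k z, h z z.2⟩⟩

/-- Obtained by projecting the Demazure element itself; for the big torus the case of `s_0` leads to
the contradiction. -/
theorem divDiff_mem_of_k_mem_fada (h : ∀ z ∈ T.relFada, T.k z ∈ T.fada) (j : J) :
    T.divDiff (T.simple j) (SemidirectProduct.inl (T.refl j).left) ∈ T.fadaSubring := by
  have := h _ ⟨_, T.demazure_mem j, rfl⟩
  change T.proj (T.divDiff (T.simple j) (T.refl j)) ∈ T.fadaSubring at this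
  rwa [divDiff, proj_scalar_mul, map_sub, proj_one, proj_η] at this

end Semidirect

end Model

/-! ### The small torus -/

namespace Model

variable {Γ J L A : Type*} [Group Γ] [AddCommGroup L] [DistribMulAction Γ L] [CommRing A]
  [MulSemiringAction Γ A] (T : Model Γ J L A)

theorem η_mul_divDiff_mul (g h : Γ) (α β : T.roots) (hβ : g • (α : L) = β) :
    T.η g * T.divDiff α h * T.η g⁻¹ = T.divDiff β (g * h * g⁻¹) := by
  rw [divDiff, divDiff, ← mul_assoc, η_mul_scalar, T.smul_invX g α β hβ, mul_assoc, mul_assoc]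
  congr 1
  rw [sub_mul, mul_sub, one_mul, η_mul, η_mul, η_mul, mul_inv_cancel, η_one, mul_assoc]

variable {T}

/-- The two elements differ by the factor `x_α / x_β`, which lies in `A`. Used to pass between a
root and its negative. -/
theorem divDiff_mem_of_dvd {α β : T.roots} {g : Γ} (h : T.x β ∣ T.x α)
    (hα : T.divDiff α g ∈ T.fadaSubring) : T.divDiff β g ∈ T.fadaSubring := by
  have : T.divDiff β g =
      T.scalar (T.invX β * algebraMap A T.Q (T.x α)) * T.divDiff α g := by
    rw [map_mul, mul_assoc, scalar_algebraMap, coeff_mul_divDiff, divDiff]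
  rw [this]
  exact mul_mem (T.scalar_invX_mul_algebraMap_mem h) hα

variable (T) in
theorem smul_Q_eq_self {g : Γ} (h : ∀ a : A, g • a = a) (q : T.Q) : g • q = q := by
  change IsLocalization.map T.Q (MulSemiringAction.toRingHom Γ A g) (T.smul_denom g) q = q
  have e : MulSemiringAction.toRingHom Γ A g = RingHom.id A := RingHom.ext h
  simp only [e, IsLocalization.map_id]

end Model

theorem dvd_of_dvd_add_sub {L A : Type*} [AddCommGroup L] [CommRing A] {x : L → A}
    (h : ∀ μ α, x α ∣ x (μ + α) - x μ) (h0 : x 0 = 0) (μ : L) : x (-μ) ∣ x μ := by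
  have := h μ (-μ)
  rwa [add_neg_cancel, h0, zero_sub, dvd_neg] at this

theorem connectiveHom_id {R : Type*} [CommRing R] (c : R) {L : Type*} [AddCommGroup L]
    (p : ConnectiveAlgebra c L) : connectiveHom c (AddMonoidHom.id L) p = p := by
  obtain ⟨p, rfl⟩ := Ideal.Quotient.mk_surjective p
  rw [connectiveHom_mk, show ⇑(AddMonoidHom.id L) = id from rfl, MvPolynomial.rename_id_apply]

section Affine

variable {ι M N : Type*} [AddCommGroup M] [AddCommGroup N] (P : RootPairing ι ℤ M N)

theorem ofIdx_inv (i : ι) :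
    (RootPairing.weylGroup.ofIdx P i)⁻¹ = RootPairing.weylGroup.ofIdx P i :=
  Subtype.ext (RootPairing.Equiv.reflection_inv P i)

theorem ofIdx_reflectionPerm (i j : ι) :
    RootPairing.weylGroup.ofIdx P (P.reflectionPerm j i) =
      RootPairing.weylGroup.ofIdx P j * RootPairing.weylGroup.ofIdx P i *
        (RootPairing.weylGroup.ofIdx P j)⁻¹ := by
  apply Subtype.ext
  refine RootPairing.Equiv.weightHom_injective P ?_
  rw [ofIdx_inv]
  exact LinearEquiv.ext fun v => DFunLike.congr_fun P.reflection_reflectionPerm v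

variable {P} (b : P.Base) (θ : ι)

section Small

variable {A : Type*} [CommRing A] [MulSemiringAction (AffineWeyl P) A]
    {x : SmallChar P → A} (hx : ∀ (g : AffineWeyl P) (μ : SmallChar P), g • x μ = x (g • μ))

/-- In a reduced root system all roots are reached from simple ones by simple reflections and sign
changes. A simple reflection conjugates one divided difference into another by units `η` of the
algebra; a sign change keeps the reflection and alters only the denominator. -/
theorem divDiff_root_mem [Finite ι] [P.IsReduced] (hneg : ∀ μ, x (-μ) ∣ x μ) (i : ι) :
    (smallModel b θ x hx).divDiff ⟨(P.root i : M), ⟨i, rfl⟩⟩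
      (SemidirectProduct.inr (RootPairing.weylGroup.ofIdx P i)) ∈
        (smallModel b θ x hx).fadaSubring := by
  induction i using b.induction_reflect with
  | h₀ i hi =>
    rw [ofIdx_reflectionPerm, mul_inv_cancel_right]
    refine Model.divDiff_mem_of_dvd ?_ hi
    have e : x (P.root (P.reflectionPerm i i) : M) = x (-(show SmallChar P from P.root i)) :=
      congrArg x (root_reflectionPerm_self P i)
    change x (P.root (P.reflectionPerm i i) : M) ∣ x (P.root i : M)
    rw [e]
    exact hneg _
  | h₁ i hi => exact (smallModel b θ x hx).demazure_mem (some ⟨i, hi⟩)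
  | h₂ i j hi hj =>
    have hs := (smallModel b θ x hx).η_refl_mem (some ⟨j, hj⟩)
    have hs' : (smallModel b θ x hx).η
        ((smallModel b θ x hx).refl (some ⟨j, hj⟩))⁻¹ ∈ (smallModel b θ x hx).fadaSubring := by
      change (smallModel b θ x hx).η
        (SemidirectProduct.inr (RootPairing.weylGroup.ofIdx P j))⁻¹ ∈ _
      rwa [← map_inv, ofIdx_inv]
    have key := mul_mem (mul_mem hs hi) hs'
    rw [(smallModel b θ x hx).η_mul_divDiff_mul _ _ _
      ⟨(P.root (P.reflectionPerm j i) : M), ⟨_, rfl⟩⟩ (P.root_reflectionPerm j i).symm] at key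
    rw [ofIdx_reflectionPerm, map_mul, map_mul, map_inv]
    exact key

theorem refl_smul_smallSimple (j : Option b.support) :
    simpleReflection b θ j • (smallSimple b θ j : SmallChar P) =
      -(smallSimple b θ j : SmallChar P) := by
  rcases j with _ | i
  · change (RootPairing.weylGroup.ofIdx P θ * 1) • (-P.root θ) = - -P.root θ
    rw [mul_one, RootPairing.weylGroup.ofIdx_smul, RootPairing.Equiv.reflection_smul, map_neg,
      RootPairing.reflection_apply_self]
  · change RootPairing.weylGroup.ofIdx P i • P.root i = -P.root i
    rw [RootPairing.weylGroup.ofIdx_smul, RootPairing.Equiv.reflection_smul,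
      RootPairing.reflection_apply_self]

theorem smallModel_k_mem_fada [Finite ι] [P.IsReduced]
    (htriv : ∀ (n : Multiplicative N) (a : A), (SemidirectProduct.inl n : AffineWeyl P) • a = a)
    (hneg : ∀ μ, x (-μ) ∣ x μ) :
    ∀ z ∈ (smallModel b θ x hx).relFada, (smallModel b θ x hx).k z ∈ (smallModel b θ x hx).fada := by
  refine Model.k_mem_fada (fun n q => ?_) (fun j => ?_) fun j => ?_
  · exact Model.smul_Q_eq_self _ (htriv n) q
  · change x _ ∣ simpleReflection b θ j • x _
    rw [hx]
    change x (smallSimple b θ j : SmallChar P) ∣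
      x (simpleReflection b θ j • (smallSimple b θ j : SmallChar P))
    rw [refl_smul_smallSimple]
    have := hneg (-(smallSimple b θ j : SmallChar P))
    rwa [neg_neg] at this
  · rcases j with _ | i
    · have e : (SemidirectProduct.inr (simpleReflection b θ none).right : AffineWeyl P)⁻¹ =
          SemidirectProduct.inr (RootPairing.weylGroup.ofIdx P θ) := by
        rw [← map_inv]
        change SemidirectProduct.inr (RootPairing.weylGroup.ofIdx P θ * 1)⁻¹ = _
        rw [mul_one, ofIdx_inv]
      change Model.divDiff _ _ (SemidirectProduct.inr (simpleReflection b θ none).right)⁻¹ ∈ _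
      rw [e]
      -- The small root attached to `s_0` is `-θ`, whereas the divided difference just constructed
      -- has denominator `x_θ`; the two are related by `x_{-θ} ∣ x_θ`.
      exact Model.divDiff_mem_of_dvd (T := smallModel b θ x hx)
        (α := ⟨(P.root θ : M), ⟨θ, rfl⟩⟩)
        (β := (smallModel b θ x hx).simple none) (hneg _) (divDiff_root_mem b θ hx hneg θ)
    · have e : (SemidirectProduct.inr (simpleReflection b θ (some i)).right : AffineWeyl P)⁻¹ =
          SemidirectProduct.inr (RootPairing.weylGroup.ofIdx P i) := by
        rw [← map_inv]
        change SemidirectProduct.inr (RootPairing.weylGroup.ofIdx P i)⁻¹ = _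
        rw [ofIdx_inv]
      change Model.divDiff _ _ (SemidirectProduct.inr (simpleReflection b θ (some i)).right)⁻¹ ∈ _
      rw [e]
      exact divDiff_root_mem b θ hx hneg i

end Small

/-! ### The big torus -/

theorem refl_smul_big (j : Option b.support) (μ : BigChar P) : ∃ k : ℤ,
    simpleReflection b θ j • μ = μ + k • (bigSimple b θ j : BigChar P) := by
  rcases j with _ | i
  · exact ⟨_, simpleReflection_none_smul b θ μ⟩
  · obtain ⟨μ, m⟩ : M × ℤ := μ
    refine ⟨-P.toLinearMap μ (P.coroot i), ?_⟩
    change bigAct P (SemidirectProduct.inr (RootPairing.weylGroup.ofIdx P i)) (μ, m) =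
      (μ, m) + -P.toLinearMap μ (P.coroot i) • ((P.root i, 0) : M × ℤ)
    refine Prod.ext ?_ ?_
    · change RootPairing.weylGroup.ofIdx P i • μ = _
      rw [RootPairing.weylGroup.ofIdx_smul, RootPairing.Equiv.reflection_smul,
        RootPairing.reflection_apply]
      simp [sub_eq_add_neg]
    · simp [bigAct]

theorem translation_smul_root :
    (SemidirectProduct.inl (simpleReflection b θ none).left : AffineWeyl P) •
      (show BigChar P from (P.root θ, 0)) = (show BigChar P from (P.root θ, -2)) := by
  -- The translation part of `s_0` is `s_0 s_θ⁻¹`: first `θ ↦ -θ`, then `s_0(-θ) = -θ - 2(-θ + δ) =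
  -- θ - 2δ`.
  rw [Model.inl_left_eq, mul_smul]
  have e : (SemidirectProduct.inr (simpleReflection b θ none).right : AffineWeyl P)⁻¹ •
      (show BigChar P from (P.root θ, 0)) = (show BigChar P from (-P.root θ, 0)) := by
    rw [← map_inv]
    change bigAct P (SemidirectProduct.inr (RootPairing.weylGroup.ofIdx P θ * 1)⁻¹) _ = _
    rw [mul_one, ofIdx_inv]
    refine Prod.ext ?_ ?_
    · change RootPairing.weylGroup.ofIdx P θ • P.root θ = -P.root θ
      rw [RootPairing.weylGroup.ofIdx_smul, RootPairing.Equiv.reflection_smul,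
        RootPairing.reflection_apply_self]
    · simp [bigAct]
  rw [e]
  refine (simpleReflection_none_smul b θ (-P.root θ, 0)).trans ?_
  refine Prod.ext ?_ ?_
  · simp [two_smul]
  · simp

variable {R : Type*} [CommRing R] [IsDomain R] [CharZero R]

/-- The map `ψ` lets one argument serve both versions: divisibility is tested in the power series
ring, which is a domain where linear parts make sense, so nothing of the kind is needed for `A`. -/
theorem bigModel_not_k_mem_fada [Module.Free ℤ M] [Module.Finite ℤ M] {A : Type*} [CommRing A]
    [MulSemiringAction (AffineWeyl P) A] {x : BigChar P → A}
    (hx : ∀ (g : AffineWeyl P) (μ : BigChar P), g • x μ = x (g • μ))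
    (hdvd : ∀ (g : AffineWeyl P) (α : BigChar P), (∀ μ : BigChar P, ∃ k : ℤ, g • μ = μ + k • α) →
      ∀ a : A, x α ∣ g • a - a)
    (F : FormalGroup R) [F.IsComm] (ψ : A →+* FormalGroupAlgebra F (BigChar P))
    (hψ : ∀ μ, ψ (x μ) = chern F μ) :
    ¬ ∀ z ∈ (bigModel b θ x hx).relFada,
      (bigModel b θ x hx).k z ∈ (bigModel b θ x hx).fada := by
  intro h
  have : NoZeroDivisors (FormalGroupAlgebra F (BigChar P)) := inferInstanceAs
    (NoZeroDivisors (MvPowerSeries (Module.Free.ChooseBasisIndex ℤ (BigChar P)) R))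
  have : Nontrivial (FormalGroupAlgebra F (BigChar P)) := inferInstanceAs
    (Nontrivial (MvPowerSeries (Module.Free.ChooseBasisIndex ℤ (BigChar P)) R))
  have : IsDomain (FormalGroupAlgebra F (BigChar P)) := NoZeroDivisors.to_isDomain _
  have key := Model.map_dvd_of_divDiff_mem
    (fun j a => hdvd (simpleReflection b θ j) _ (refl_smul_big b θ j) a) ψ (fun μ hμ => by
      change ψ (x μ) ≠ 0
      rw [hψ]
      refine chern_ne_zero F ?_
      obtain ⟨⟨i, m⟩, rfl⟩ := hμ
      exact fun h0 => P.ne_zero i (congrArg Prod.fst h0))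
    (Model.divDiff_mem_of_k_mem_fada h none) (x (show BigChar P from (P.root θ, 0)))
  change ψ (x (show BigChar P from (-P.root θ, 1))) ∣ ψ (_ -
    (SemidirectProduct.inl (simpleReflection b θ none).left : AffineWeyl P) • _) at key
  rw [hx, translation_smul_root, map_sub, hψ, hψ, hψ] at key
  -- `f(μ + mδ) = ⟨μ, θ^∨⟩ + 2m`, chosen to vanish on `α_0 = -θ + δ`. It takes the values `2` on `θ`
  -- and `-2` on `θ - 2δ`, so these are not congruent modulo `α_0`.
  let f : M × ℤ →+ ℤ := AddMonoidHom.coprod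
    ((LinearMap.flip P.toLinearMap (P.coroot θ)).toAddMonoidHom) (AddMonoidHom.mulLeft 2)
  have := map_eq_zero_of_chern_dvd_sub F (f := (show BigChar P →+ ℤ from f)) (by
    change f (-P.root θ, 1) = 0
    simp [f]) key
  change f (P.root θ, 0) = f (P.root θ, -2) at this
  simp [f] at this


end Affine

end AffineFADA

end

/-! ### Specialisation to the power series and the polynomial versions -/

theorem mainTheorem7 {ι M N : Type*} [Finite ι] [AddCommGroup M] [AddCommGroup N]
    [Module.Free ℤ M] [Module.Finite ℤ M] (P : RootPairing ι ℤ M N) [P.IsReduced]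
    (hP : AffineFADA.IsSimpleSimplyConnected P) (b : P.Base) (θ : ι)
    (hθ : AffineFADA.IsHighestRoot b θ) {R : Type*} [CommRing R] [IsDomain R] [CharZero R] :
    (∀ (F : FormalGroup R) [F.IsComm],
      -- the small torus
      (let T := AffineFADA.smallTorus b θ F
       (∀ f ∈ T.integralDual T.fada, T.kDual f ∈ T.integralDual T.relFada) ∧
         ∀ z ∈ T.relFada, T.k z ∈ T.fada) ∧
      -- the big torus
      (let T := AffineFADA.bigTorus b θ F
       ¬ ∀ z ∈ T.relFada, T.k z ∈ T.fada)) ∧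
    (∀ c : R,
      -- the small torus, polynomial version for the connective formal group law
      (let T := AffineFADA.smallTorusConnective b θ c
       (∀ f ∈ T.integralDual T.fada, T.kDual f ∈ T.integralDual T.relFada) ∧
         ∀ z ∈ T.relFada, T.k z ∈ T.fada) ∧
      -- the big torus, polynomial version for the connective formal group law
      (let T := AffineFADA.bigTorusConnective b θ c
       ¬ ∀ z ∈ T.relFada, T.k z ∈ T.fada)) := by
  refine ⟨fun F _ => ⟨?_, ?_⟩, fun c => ⟨?_, ?_⟩⟩
  · have h := AffineFADA.smallModel_k_mem_fada b θ
      (AffineFADA.smul_chern (L := AffineFADA.SmallChar P) F)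
      -- A translation has trivial component in `W`, so it induces the identity on `T^*` and hence
      -- on `S`.
      (fun n a => (congrArg (AffineFADA.inducedHom F · a) (AddMonoidHom.ext fun μ =>
        one_smul P.weylGroup (show M from μ))).trans (AffineFADA.inducedHom_id F a))
      (AffineFADA.dvd_of_dvd_add_sub (AffineFADA.chern_dvd_chern_add_sub F)
        (AffineFADA.chernSeries_zero F))
    exact ⟨AffineFADA.Model.kDual_mem_integralDual h, h⟩
  · exact AffineFADA.bigModel_not_k_mem_fada b θ (AffineFADA.smul_chern F)
      (fun g α h => AffineFADA.chern_dvd_smul_sub F h) F (RingHom.id _) fun _ => rfl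
  · have h := AffineFADA.smallModel_k_mem_fada b θ
      (AffineFADA.smul_connectiveChern (L := AffineFADA.SmallChar P) c)
      (fun n a => (congrArg (AffineFADA.connectiveHom c · a) (AddMonoidHom.ext fun μ =>
        one_smul P.weylGroup (show M from μ))).trans (AffineFADA.connectiveHom_id c a))
      (AffineFADA.dvd_of_dvd_add_sub (AffineFADA.connectiveChern_dvd_add_sub c)
        (AffineFADA.connectiveChern_zero c))
    exact ⟨AffineFADA.Model.kDual_mem_integralDual h, h⟩
  -- Only the existence of the comparison map to power series is used, not its injectivity.
  · exact AffineFADA.bigModel_not_k_mem_fada b θ (AffineFADA.smul_connectiveChern c)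
      (fun g α h => AffineFADA.connectiveChern_dvd_smul_sub c h)
      (AffineFADA.connectiveGroup c) (AffineFADA.connectiveToSeries c)
      (AffineFADA.connectiveToSeries_chern c)
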